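/- Let $(\Omega,\mathcal A,\mu)$ be an arbitrary measure space and $M$ a complete metric space. An *atom* is a set $A\in\mathcal A$ with $\mu(A)>0$ such that every measurable $B\subset A$ has $\mu(B)\in\{0,\mu(A)\}$ (for $\mu(A)=\infty$: $\mu(B)\in\{0,\infty\}$). Let $\mathcal A_{a\sigma}$ be the system of all unions of countably many atoms and one measurable $\sigma$-finite set, and let $\mathcal S(M)$ be the separable subsets of $M$. A property holds *integrally a.e.* (i.a.e.) if its exceptional set meets every atom and every $\sigma$-finite set in a null set; if the exceptional set is measurable for the completion of $\mu$, this is the same as a.e. A function $u\colon\Omega\to M$ is *integrally strongly measurable* if it is strongly measurable on every atom and every $\sigma$-finite set. An integrand $f\colon\Omega\times M\to[-\infty,\infty]$ is *integrally separably measurable* if for every $W\in\mathcal S(M)$ and every $A$ that is an atom or a $\sigma$-finite set, $f|_{A\times W}$ is measurable for the product of the trace $\sigma$-algebra of $\mathcal A$ on $A$ and the Borel $\sigma$-algebra of $W$. The *exhausting integral* of a family $\alpha_A\colon A\to[-\infty,\infty]$, $A\in\mathcal A_{a\sigma}$, with $\alpha_A=\alpha_B$ a.e. on $A\cap B$, is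 $\int\alpha=P-N$ with $P=\sup_{A\in\mathcal A_{a\sigma}}\int_A\alpha_A^+\,d\bar\mu$ and $N=\sup_{A\in\mathcal A_{a\sigma}}\int_A\alpha_A^-\,d\bar\mu$, where $\infty-\infty=\infty$; a single function $\alpha$ is regarded as the family of its restrictions. Put $I_f(u)=\int f[\omega,u(\omega)]\,d\mu(\omega)$ in this sense. A set $R$ of functions $\Omega\to M$ is *almost decomposable* if for all $u_0\in R$, all $F\in\mathcal A$ with $\mu(F)<\infty$, all $\varepsilon>0$ and all bounded strongly measurable $u_1\colon F\to M$ there is a measurable $F_\varepsilon\subset F$ with $\mu(F\setminus F_\varepsilon)<\varepsilon$ such that the function equal to $u_1$ on $F_\varepsilon$ and to $u_0$ on $\Omega\setminus F_\varepsilon$ belongs to $R$. The *essential infimum function* on $A\in\mathcal A_{a\sigma}$ of a family of functions $v_i$ is a function $m$ on $A$, measurable for the completion, with $m\le v_i$ a.e. on $A$ for every $i$, and such that every other such function $n$ satisfies $n\le m$ a.e. on $A$. The essential infimum function on $\Omega$ is defined in the same way, with $m\le v_i$ and $n\le v_i$ required i.a.e. on $\Omega$. **Theorem.** Let $R$ be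 an almost decomposable set of integrally strongly measurable functions $\Omega\to M$ and $f\colon\Omega\times M\to[-\infty,\infty]$ an integrally separably measurable integrand. Suppose that for every atom $A$ with $\mu(A)=\infty$ and every $W\in\mathcal S(M)$ there holds $\inf_{x\in W}f(\omega,x)\ge0$ for a.e. $\omega\in A$. If $I_f\not\equiv\infty$ on $R$, then the essential infimum function $m_A$ of the family $\inf_{x\in W}f(\cdot,x)$, $W\in\mathcal S(M)$, exists on every $A\in\mathcal A_{a\sigma}$, and $$\inf_{u\in R}I_f(u)=\int\operatorname*{ess\,inf}_{W\in\mathcal S(M)}\ \inf_{x\in W}f(\omega,x)\,d\bar\mu(\omega),$$ the right-hand side being the exhausting integral of the family $(m_A)$. Moreover, if this common value is not $-\infty$, then the essential infimum function $\bar m$ of the family exists on all of $\Omega$, and the common value equals $\int\bar m\,d\bar\mu$. For every $A\in\mathcal A_{a\sigma}$ there is $W\in\mathcal S(M)$ with $\bar m=\inf_{x\in W}f(\cdot,x)$ a.e. on $A$. If some $u\in R$ with $I_f(u)<\infty$ takes its values i.a.e. in a separable set (for instance, if the elements of $R$ are strongly measurable on $\Omega$), then there is a single $W\in\mathcal S(M)$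 with $\bar m=\inf_{x\in W}f(\cdot,x)$ i.a.e. on $\Omega$. Finally, for $\bar u\in R$, $$\bar u\in\operatorname*{Arg\,min}_{u\in R}I_f(u)\iff f[\omega,\bar u(\omega)]=\bar m(\omega)\ \text{ i.a.e.},$$ and here "i.a.e." may be replaced by "$\mu$-a.e." whenever $\omega\mapsto f[\omega,\bar u(\omega)]$ is measurable for the completion of $\mu$. -/

import Mathlib

open MeasureTheory Set TopologicalSpace
open scoped ENNReal

noncomputable section

namespace InfInt

variable {Ω M : Type*} [MeasurableSpace Ω]

/-- An atom: a measurable set of positive measure each of whose measurable subsets has either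
measure zero or full measure. For `μ A = ∞` this says that every measurable subset has measure
`0` or `∞`; thus a measure without atoms has the finite subset property. -/
def IsMeasureAtom (μ : Measure Ω) (A : Set Ω) : Prop :=
  MeasurableSet A ∧ μ A ≠ 0 ∧ ∀ B ⊆ A, MeasurableSet B → μ B = 0 ∨ μ B = μ A

/-- A measurable set of `σ`-finite measure. -/
def IsSigmaFiniteSet (μ : Measure Ω) (A : Set Ω) : Prop :=
  MeasurableSet A ∧ SigmaFinite (μ.restrict A)

/-- The sets on which an "integral" property is tested: atoms and `σ`-finite sets. -/
def IsTestSet (μ : Measure Ω) (A : Set Ω) : Prop :=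
  IsMeasureAtom μ A ∨ IsSigmaFiniteSet μ A

/-- The `σ`-ring of all unions of countably many atoms and a `σ`-finite set. -/
def atomSigmaRing (μ : Measure Ω) : Set (Set Ω) :=
  {A | ∃ C : Set (Set Ω), C.Countable ∧ (∀ S ∈ C, IsMeasureAtom μ S) ∧
    ∃ B, IsSigmaFiniteSet μ B ∧ A = ⋃₀ C ∪ B}

/-- A property holds integrally almost everywhere if its exceptional set meets every atom and
every `σ`-finite set in a null set. -/
def IntAE (μ : Measure Ω) (p : Ω → Prop) : Prop :=
  ∀ A, IsTestSet μ A → μ ({ω | ¬ p ω} ∩ A) = 0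

/-- If the exceptional set is measurable with respect to the completion, then "integrally almost
everywhere" is the same as "almost everywhere". -/
theorem intAE_iff_ae {μ : Measure Ω} {p : Ω → Prop} (hp : NullMeasurableSet {ω | ¬ p ω} μ) :
    IntAE μ p ↔ ∀ᵐ ω ∂μ, p ω := by
  rw [ae_iff]
  refine ⟨fun h => ?_, fun h A _ => measure_mono_null inter_subset_left h⟩
  obtain ⟨N, hsub, hN, hNe⟩ := hp.exists_measurable_subset_ae_eq
  rw [← measure_congr hNe]
  by_contra h0
  have key : ∀ F ⊆ N, IsTestSet μ F → μ F = 0 := fun F hF hT => by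
    have := h F hT
    rwa [inter_eq_self_of_subset_right (hF.trans hsub)] at this
  by_cases hA : IsMeasureAtom μ N
  · exact h0 (key N subset_rfl (Or.inl hA))
  · simp only [IsMeasureAtom, not_and, not_forall, not_or] at hA
    obtain ⟨F, hFN, hF, hF0, hF1⟩ := hA hN h0
    have hfin : μ F < ∞ := by
      refine lt_of_le_of_ne le_top fun hT => hF1 ?_
      rw [hT, eq_comm, eq_top_iff, ← hT]
      exact measure_mono hFN
    have : IsFiniteMeasure (μ.restrict F) := ⟨by simpa using hfin⟩
    exact hF0 (key F hFN (Or.inr ⟨hF, inferInstance⟩))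

/-- The exhausting integral of a family `α A`, `A` in the `σ`-ring of countable unions of atoms
and a `σ`-finite set: the suprema of the integrals of the positive and of the negative parts are
subtracted, with the convention `∞ - ∞ = ∞`. -/
def exhIntegralFamily (μ : Measure Ω) (α : Set Ω → Ω → EReal) : EReal :=
  let P : ℝ≥0∞ := ⨆ A ∈ atomSigmaRing μ, ∫⁻ ω in A, (α A ω).toENNReal ∂μ
  let N : ℝ≥0∞ := ⨆ A ∈ atomSigmaRing μ, ∫⁻ ω in A, (-α A ω).toENNReal ∂μ
  if P = ∞ then ⊤ else (P : EReal) - (N : EReal)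

/-- The exhausting integral of a single function. -/
def exhIntegral (μ : Measure Ω) (α : Ω → EReal) : EReal :=
  exhIntegralFamily μ fun _ => α

/-- The integral functional `I_f`. -/
def integralFunctional (μ : Measure Ω) (f : Ω → M → EReal) (u : Ω → M) : EReal :=
  exhIntegral μ fun ω => f ω (u ω)

/-- `m` is the essential infimum function of the family `v` on `A`: the greatest lower bound
almost everywhere on `A` among functions that are measurable for the completion. -/
def IsEssInfOn {ι : Type*} (μ : Measure Ω) (A : Set Ω) (v : ι → Ω → EReal) (m : Ω → EReal) :
    Prop :=
  AEMeasurable m (μ.restrict A) ∧ (∀ i, ∀ᵐ ω ∂μ.restrict A, m ω ≤ v i ω) ∧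
    ∀ n : Ω → EReal, AEMeasurable n (μ.restrict A) →
      (∀ i, ∀ᵐ ω ∂μ.restrict A, n ω ≤ v i ω) → ∀ᵐ ω ∂μ.restrict A, n ω ≤ m ω

/-- `m` is the essential infimum function of the family `v` on the whole space, for families
whose members need only be integrally measurable. -/
def IsEssInf {ι : Type*} (μ : Measure Ω) (v : ι → Ω → EReal) (m : Ω → EReal) : Prop :=
  AEMeasurable m μ ∧ (∀ i, IntAE μ fun ω => m ω ≤ v i ω) ∧
    ∀ n : Ω → EReal, AEMeasurable n μ →
      (∀ i, IntAE μ fun ω => n ω ≤ v i ω) → ∀ᵐ ω ∂μ, n ω ≤ m ω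

/-- The pointwise infimum `ω ↦ inf_W f(ω, ·)`. -/
def infOver (f : Ω → M → EReal) (W : Set M) (ω : Ω) : EReal := ⨅ x ∈ W, f ω x

/-- The family `inf_W f` indexed by the separable subsets `W` of `M`. -/
def infFamily [TopologicalSpace M] (f : Ω → M → EReal) (W : {W : Set M // IsSeparable W}) :
    Ω → EReal :=
  infOver f W.1

/-- Integral strong measurability: strong measurability on every atom and `σ`-finite set. -/
def IntStronglyMeasurable [TopologicalSpace M] (μ : Measure Ω) (u : Ω → M) : Prop :=
  ∀ A, IsTestSet μ A → StronglyMeasurable fun ω : A => u ω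

/-- Integral separable measurability: for `W` separable and `A` an atom or a `σ`-finite set, the
restriction of the integrand to `A × W` is product measurable. -/
def IntSeparablyMeasurable [TopologicalSpace M] [MeasurableSpace M] (μ : Measure Ω)
    (f : Ω → M → EReal) : Prop :=
  ∀ A, IsTestSet μ A → ∀ W : Set M, IsSeparable W →
    Measurable fun p : A × W => f p.1 p.2

open Classical in
/-- Almost decomposability of a space of functions. Only the restriction of `u₁` to `F`
matters. -/
def AlmostDecomposable [PseudoMetricSpace M] (μ : Measure Ω) (R : Set (Ω → M)) : Prop :=
  ∀ u₀ ∈ R, ∀ F : Set Ω, MeasurableSet F → μ F < ∞ → ∀ ε : ℝ≥0∞, 0 < ε →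
    ∀ u₁ : Ω → M, StronglyMeasurable (fun ω : F => u₁ ω) → Bornology.IsBounded (u₁ '' F) →
      ∃ G ⊆ F, MeasurableSet G ∧ μ (F \ G) < ε ∧ G.piecewise u₁ u₀ ∈ R

end InfInt

end

/-! Let `u₀ ∈ R` have `I_f(u₀) < ∞`, and let `p` be the positive part of `f(·, u₀)`, which has
finite integral. Subtracting from `∫ p` turns the infimum of `I_f` into a supremum of integrals of
the nonnegative gaps `p - f(·, u)`. The gaps vanish on infinite atoms, where integrability forces
`p = 0` and the hypothesis gives `f(·, u) ≥ 0`. On a `σ`-finite set the essential infimum is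
`inf_W f` for one closed separable `W`; by measurable selection on a large set of finite measure,
some bounded function with values in `W` almost attains it, and almost decomposability glues this
function into `u₀` off a small set.

If the value is finite, the essential infima on the members of the `σ`-ring vanish off a single
member, up to null sets, so they glue to a function on `Ω`. The minimizers are then characterized
by the equality case of monotonicity of the integral. -/

namespace InfInt

section Selection

theorem exists_eq_preimage_prodMap_cantor {Ω X : Type*} [MeasurableSpace Ω] [MeasurableSpace X]
    {G : Set (Ω × X)} (hG : MeasurableSet G) :
    ∃ φ : Ω → ℕ → Bool, Measurable φ ∧ ∃ G' : Set ((ℕ → Bool) × X), MeasurableSet G' ∧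
      G = Prod.map φ id ⁻¹' G' := by
  classical
  rw [← generateFrom_prod] at hG
  induction G, hG using MeasurableSpace.generateFrom_induction with
  | hC t ht _ =>
    obtain ⟨s, hs, t, ht', rfl⟩ := ht
    refine ⟨fun ω _ => decide (ω ∈ s), ?_, ((fun y => y 0) ⁻¹' {true}) ×ˢ t, ?_, ?_⟩
    · exact measurable_pi_lambda _ fun _ => measurable_to_bool (by simpa [preimage] using hs)
    · exact ((measurable_pi_apply 0) (measurableSet_singleton _)).prod ht'
    · ext ⟨ω, x⟩
      simp
  | empty => exact ⟨fun _ _ => true, measurable_const, ∅, .empty, by simp⟩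
  | compl t _ ih =>
    obtain ⟨φ, hφ, G', hG', rfl⟩ := ih
    exact ⟨φ, hφ, G'ᶜ, hG'.compl, by simp⟩
  | iUnion s _ ih =>
    choose φ hφ G' hG' hs using ih
    -- Countably many maps to the Cantor space are coded by one.
    let e := cantorSpaceHomeomorphNatToCantorSpace
    refine ⟨fun ω => e.symm fun n => φ n ω,
      e.symm.continuous.measurable.comp (measurable_pi_lambda _ hφ),
      ⋃ n, Prod.map (fun y => e y n) id ⁻¹' G' n, .iUnion fun n => ?_, ?_⟩
    · exact (((continuous_apply n).comp e.continuous).measurable.prodMap measurable_id) (hG' n)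
    · ext ⟨ω, x⟩
      simp [hs]

theorem image_fst_preimage_prodMap_id {Ω X Y : Type*} (φ : Ω → Y) (G : Set (Y × X)) :
    Prod.fst '' (Prod.map φ id ⁻¹' G) = φ ⁻¹' (Prod.fst '' G) := by
  ext ω
  simp

theorem isCompact_Iic_baire (n : ℕ → ℕ) : IsCompact (Iic n) := by
  rw [← Icc_bot]
  exact isCompact_Icc

theorem exists_cylinder_subset_of_Iic_subset {n : ℕ → ℕ} {O : Set (ℕ → ℕ)} (hO : IsOpen O)
    (hn : Iic n ⊆ O) : ∃ k, {x : ℕ → ℕ | ∀ i < k, x i ≤ n i} ⊆ O := by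
  suffices ∃ k, ∀ x : ℕ → ℕ, (∀ i < k, x i ≤ n i) → x ⊓ n ∈ Iic n → x ∈ O by
    obtain ⟨k, hk⟩ := this
    exact ⟨k, fun x hx => hk x hx (mem_Iic.2 inf_le_right)⟩
  refine (isCompact_Iic_baire n).induction_on (p := fun T => ∃ k, ∀ x : ℕ → ℕ,
    (∀ i < k, x i ≤ n i) → x ⊓ n ∈ T → x ∈ O) ⟨0, by simp⟩ ?_ ?_ fun z hz => ?_
  · rintro s t hst ⟨k, hk⟩
    exact ⟨k, fun x hx hs => hk x hx (hst hs)⟩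
  · rintro s t ⟨k, hk⟩ ⟨l, hl⟩
    exact ⟨max k l, fun x hx hs => hs.elim (hk x fun i hi => hx i (lt_max_of_lt_left hi))
      (hl x fun i hi => hx i (lt_max_of_lt_right hi))⟩
  · obtain ⟨_, ⟨y, k, rfl⟩, hzy, hyO⟩ :=
      (PiNat.isTopologicalBasis_cylinders (fun _ => ℕ)).exists_subset_of_mem_open (hn hz) hO
    rw [← PiNat.mem_cylinder_iff_eq.1 hzy] at hyO
    refine ⟨PiNat.cylinder z k, mem_nhdsWithin_of_mem_nhds ((PiNat.isOpen_cylinder _ z k).mem_nhds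
      (PiNat.self_mem_cylinder z k)), k, fun x hx hxz => hyO fun i hi => ?_⟩
    rw [← hxz i hi]
    simpa using hx i hi

theorem exists_lt_measure_image_inter_le {X Y : Type*} [MeasurableSpace Y] {ν : Measure Y}
    {g : X → Y} {S : Set X} {c : ℝ≥0∞} (h : X → ℕ) (hS : c < ν (g '' S)) :
    ∃ l, c < ν (g '' (S ∩ {x | h x ≤ l})) := by
  have hmono : Monotone fun l => g '' (S ∩ {x | h x ≤ l}) := fun a b hab =>
    image_mono (inter_subset_inter_right _ fun x (hx : h x ≤ a) => hx.trans hab)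
  have hS' : S = ⋃ l, S ∩ {x | h x ≤ l} := by
    rw [← inter_iUnion, iUnion_eq_univ_iff.2 fun x => ⟨h x, le_refl (h x)⟩, inter_univ]
  rwa [hS', image_iUnion, hmono.measure_iUnion, lt_iSup_iff] at hS

theorem exists_forall_lt_measure_image_cylinder {Y : Type*} [MeasurableSpace Y] {ν : Measure Y}
    {g : (ℕ → ℕ) → Y} {c : ℝ≥0∞} (hc : c < ν (range g)) :
    ∃ n : ℕ → ℕ, ∀ k, c < ν (g '' {x | ∀ i < k, x i ≤ n i}) := by
  choose! l hl using fun (S : Set (ℕ → ℕ)) (k : ℕ) (hS : c < ν (g '' S)) =>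
    exists_lt_measure_image_inter_le (fun x => x k) hS
  let S : ℕ → Set (ℕ → ℕ) := fun k => Nat.rec univ (fun k S => S ∩ {x | x k ≤ l S k}) k
  have hS : ∀ k, c < ν (g '' S k) := by
    intro k
    induction k with
    | zero => simpa [S] using hc
    | succ k ih => exact hl _ _ ih
  refine ⟨fun k => l (S k) k, fun k => ?_⟩
  convert hS k
  induction k with
  | zero => simp [S]
  | succ k ih =>
    ext x
    change _ ↔ x ∈ S k ∧ x k ≤ l (S k) k
    simp only [← Set.ext_iff.1 ih x, mem_ofPred_eq, Nat.forall_lt_succ_right]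

variable {Y : Type*} [TopologicalSpace Y] [T2Space Y] [MeasurableSpace Y] [OpensMeasurableSpace Y]

theorem exists_le_measure_image_Iic (ν : Measure Y) [IsFiniteMeasure ν]
    {g : (ℕ → ℕ) → Y} (hg : Continuous g) {c : ℝ≥0∞} (hc : c < ν (range g)) :
    ∃ n : ℕ → ℕ, c ≤ ν (g '' Iic n) := by
  obtain ⟨n, hn⟩ := exists_forall_lt_measure_image_cylinder hc
  let S : ℕ → Set (ℕ → ℕ) := fun k => {x | ∀ i < k, x i ≤ n i}
  have hanti : Antitone fun k => closure (g '' S k) := fun k l hkl =>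
    closure_mono (image_mono fun x hx i hi => hx i (hi.trans_le hkl))
  have hsub : ⋂ k, closure (g '' S k) ⊆ g '' Iic n := by
    intro y hy
    by_contra hyK
    obtain ⟨U, V, hU, hV, hKU, hyV, hUV⟩ :=
      SeparatedNhds.of_isCompact_isCompact ((isCompact_Iic_baire n).image hg)
        (isCompact_singleton (x := y)) (disjoint_singleton_right.2 hyK)
    obtain ⟨k, hk⟩ := exists_cylinder_subset_of_Iic_subset (hU.preimage hg) (image_subset_iff.1 hKU)
    exact (hUV.closure_left hV).le_bot
      ⟨closure_mono (image_subset_iff.2 hk) (mem_iInter.1 hy k), hyV rfl⟩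
  refine ⟨n, le_trans ?_ (measure_mono hsub)⟩
  rw [hanti.measure_iInter (fun k => isClosed_closure.measurableSet.nullMeasurableSet)
    ⟨0, measure_ne_top _ _⟩]
  exact le_iInf fun k => (hn k).le.trans (measure_mono subset_closure)

theorem exists_forall_le_of_countablyDirected {α ι : Type*} [CompleteLinearOrder α]
    [TopologicalSpace α] [OrderTopology α] [FirstCountableTopology α] [Nonempty ι] {Φ : ι → α}
    (hΦ : ∀ s : ℕ → ι, ∃ i, ∀ n, Φ (s n) ≤ Φ i) : ∃ i, ∀ j, Φ j ≤ Φ i := by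
  obtain ⟨v, -, hv, hvΦ⟩ := exists_seq_tendsto_sSup (range_nonempty Φ) (OrderTop.bddAbove _)
  choose s hs using hvΦ
  obtain ⟨i, hi⟩ := hΦ s
  exact ⟨i, fun j => (le_sSup (mem_range_self j)).trans
    (le_of_tendsto' hv fun n => (hs n).symm.trans_le (hi n))⟩

theorem nullMeasurableSet_of_analyticSet (ν : Measure Y) [SFinite ν] {A : Set Y}
    (hA : AnalyticSet A) : NullMeasurableSet A ν := by
  suffices NullMeasurableSet A ν.toFinite from this.mono_ac (absolutelyContinuous_toFinite ν)
  rw [AnalyticSet] at hA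
  obtain rfl | ⟨g, hg, rfl⟩ := hA
  · exact MeasurableSet.empty.nullMeasurableSet
  have : Nonempty {F : Set Y // MeasurableSet F ∧ F ⊆ range g} := ⟨∅, .empty, empty_subset _⟩
  obtain ⟨⟨F, hF, hFg⟩, hmax⟩ := exists_forall_le_of_countablyDirected
    (Φ := fun F : {F : Set Y // MeasurableSet F ∧ F ⊆ range g} => ν.toFinite F) fun s =>
    ⟨⟨⋃ n, s n, .iUnion fun n => (s n).2.1, iUnion_subset fun n => (s n).2.2⟩,
      fun n => measure_mono (subset_iUnion (fun n => (s n : Set Y)) n)⟩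
  refine hF.nullMeasurableSet.congr (ae_eq_of_subset_of_measure_ge hFg ?_ hF.nullMeasurableSet
    (measure_ne_top _ _))
  refine le_of_forall_lt_imp_le_of_dense fun c hc => ?_
  obtain ⟨n, hn⟩ := exists_le_measure_image_Iic ν.toFinite hg hc
  exact hn.trans (hmax ⟨_, ((isCompact_Iic_baire n).image hg).measurableSet,
    image_subset_range _ _⟩)

theorem exists_measurable_section_of_isCompact_real {Z : Set ℝ} (hZ : IsCompact Z) {g : Z → Y}
    (hg : Continuous g) : ∃ σ : range g → Z, Measurable σ ∧ ∀ y, g (σ y) = y := by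
  have : CompactSpace Z := isCompact_iff_compactSpace.1 hZ
  -- Each point of the range is sent to the smallest point of its fibre.
  let fibre : Y → Set ℝ := fun y => Subtype.val '' (g ⁻¹' {y})
  have hfibre : ∀ y, IsCompact (fibre y) := fun y =>
    (isClosed_singleton.preimage hg).isCompact.image continuous_subtype_val
  have hmem : ∀ y : range g, sInf (fibre y) ∈ fibre y := by
    rintro ⟨_, z, rfl⟩
    exact (hfibre _).sInf_mem ⟨z, z, rfl, rfl⟩
  choose σ hσ hσ' using hmem
  refine ⟨σ, (MeasurableEmbedding.subtype_coe hZ.measurableSet).measurable_comp_iff.1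
    (measurable_of_Iic fun c => ?_), hσ⟩
  have hpre : (Subtype.val ∘ σ) ⁻¹' Iic c = Subtype.val ⁻¹' (g '' {z : Z | (z : ℝ) ≤ c}) := by
    ext y
    refine ⟨fun h => ⟨σ y, h, hσ y⟩, fun ⟨z, hz, hzy⟩ => ?_⟩
    exact (hσ' y).trans_le ((csInf_le (hfibre y).bddBelow ⟨z, hzy, rfl⟩).trans hz)
  have hclosed : IsClosed {z : Z | (z : ℝ) ≤ c} :=
    isClosed_le continuous_subtype_val continuous_const
  rw [hpre]
  exact measurable_subtype_coe (hclosed.isCompact.image hg).measurableSet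

theorem exists_measurable_rightInvOn_range {K : Type*} [TopologicalSpace K] [CompactSpace K]
    [MetrizableSpace K] [Nonempty K] [MeasurableSpace K] [BorelSpace K] {g : K → Y}
    (hg : Continuous g) : ∃ σ : Y → K, Measurable σ ∧ ∀ y ∈ range g, g (σ y) = y := by
  let _ : MetricSpace K := metrizableSpaceMetric K
  obtain ⟨p, hp, hsurj⟩ := exists_nat_bool_continuous_surjective_of_compact K
  have : CompactSpace cantorSet := isCompact_iff_compactSpace.1 isCompact_cantorSet
  let q : cantorSet → K := p ∘ cantorSetHomeomorphNatToBool
  have hq : Continuous q := hp.comp cantorSetHomeomorphNatToBool.continuous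
  have hrange : range (g ∘ q) = range g :=
    (hsurj.comp cantorSetHomeomorphNatToBool.surjective).range_comp g
  obtain ⟨σ, hσ, hgσ⟩ := exists_measurable_section_of_isCompact_real isCompact_cantorSet
    (hg.comp hq)
  obtain ⟨τ, hτ, hτσ⟩ := (MeasurableEmbedding.subtype_coe
    (isCompact_range (hg.comp hq)).measurableSet).exists_measurable_extend
    (hq.measurable.comp hσ) fun _ => ‹_›
  refine ⟨τ, hτ, fun y hy => ?_⟩
  rw [← hrange] at hy
  exact (congrArg g (congrFun hτσ ⟨y, hy⟩)).trans (hgσ ⟨y, hy⟩)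

variable {Ω X : Type*} [MeasurableSpace Ω] [TopologicalSpace X] [MeasurableSpace X] [BorelSpace X]

theorem exists_measurable_selection_of_analyticSet (ν : Measure Y) [IsFiniteMeasure ν]
    {A : Set (Y × X)} (hA : AnalyticSet A) {c : ℝ≥0∞} (hc : c < ν (Prod.fst '' A)) :
    ∃ F : Set Y, MeasurableSet F ∧ c ≤ ν F ∧ ∃ u : Y → X, Measurable u ∧
      ∀ y ∈ F, (y, u y) ∈ A := by
  rw [AnalyticSet] at hA
  obtain rfl | ⟨g, hg, rfl⟩ := hA
  · simp at hc
  rw [← range_comp] at hc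
  obtain ⟨n, hn⟩ := exists_le_measure_image_Iic ν (continuous_fst.comp hg) hc
  have : CompactSpace (Iic n) := isCompact_iff_compactSpace.1 (isCompact_Iic_baire n)
  have : Nonempty (Iic n) := ⟨n, mem_Iic.2 le_rfl⟩
  have hgn : Continuous fun z : Iic n => g z := hg.comp continuous_subtype_val
  obtain ⟨σ, hσ, hgσ⟩ := exists_measurable_rightInvOn_range (continuous_fst.comp hgn)
  refine ⟨_, ((isCompact_Iic_baire n).image (continuous_fst.comp hg)).measurableSet, hn,
    fun y => (g (σ y)).2, (continuous_snd.comp hgn).measurable.comp hσ, ?_⟩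
  rintro _ ⟨x, hx, rfl⟩
  exact ⟨σ (g x).1, Prod.ext (hgσ _ ⟨⟨x, hx⟩, rfl⟩) rfl⟩

instance polishSpace_cantor : PolishSpace (ℕ → Bool) :=
  have := isClosed_cantorSet.polishSpace
  cantorSetHomeomorphNatToBool.symm.isClosedEmbedding.polishSpace

variable [PolishSpace X]

theorem nullMeasurableSet_image_fst (ν : Measure Ω) [SFinite ν] {G : Set (Ω × X)}
    (hG : MeasurableSet G) : NullMeasurableSet (Prod.fst '' G) ν := by
  obtain ⟨φ, hφ, G', hG', rfl⟩ := exists_eq_preimage_prodMap_cantor hG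
  rw [image_fst_preimage_prodMap_id]
  exact (nullMeasurableSet_of_analyticSet (ν.map φ) (hG'.analyticSet.image_of_continuous
    continuous_fst)).preimage ⟨hφ, .rfl⟩

theorem exists_measurable_selection (ν : Measure Ω) [IsFiniteMeasure ν] {G : Set (Ω × X)}
    (hG : MeasurableSet G) {c : ℝ≥0∞} (hc : c < ν (Prod.fst '' G)) :
    ∃ F : Set Ω, MeasurableSet F ∧ c ≤ ν F ∧ ∃ u : Ω → X, Measurable u ∧
      ∀ ω ∈ F, (ω, u ω) ∈ G := by
  obtain ⟨φ, hφ, G', hG', rfl⟩ := exists_eq_preimage_prodMap_cantor hG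
  rw [image_fst_preimage_prodMap_id] at hc
  obtain ⟨F, hF, hcF, u, hu, hFu⟩ := exists_measurable_selection_of_analyticSet (ν.map φ)
    hG'.analyticSet (hc.trans_le (Measure.le_map_apply hφ.aemeasurable _))
  rw [Measure.map_apply hφ hF] at hcF
  exact ⟨φ ⁻¹' F, hφ hF, hcF, u ∘ φ, hu.comp hφ, fun ω hω => hFu _ hω⟩

theorem exists_measurable_bounded_selection {X : Type*} [MetricSpace X] [PolishSpace X]
    [MeasurableSpace X] [BorelSpace X] (ν : Measure Ω) [IsFiniteMeasure ν] {G : Set (Ω × X)}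
    (hG : MeasurableSet G) {c : ℝ≥0∞} (hc : c < ν (Prod.fst '' G)) :
    ∃ F : Set Ω, MeasurableSet F ∧ c < ν F ∧ ∃ u : Ω → X, Measurable u ∧
      Bornology.IsBounded (u '' F) ∧ ∀ ω ∈ F, (ω, u ω) ∈ G := by
  obtain ⟨c', hcc', hc'⟩ := exists_between hc
  obtain ⟨F, hF, hcF, u, hu, hFu⟩ := exists_measurable_selection ν hG hc'
  have hcνF : c < ν F := hcc'.trans_le hcF
  obtain ⟨ω₀, -⟩ : F.Nonempty := nonempty_of_measure_ne_zero (bot_lt_of_lt hcνF).ne'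
  let h : Ω → ℕ := fun ω => ⌈dist (u ω) (u ω₀)⌉₊
  have hh : Measurable h := (hu.dist measurable_const).nat_ceil
  obtain ⟨l, hl⟩ := exists_lt_measure_image_inter_le (g := id) (S := F) h
    (by rwa [image_id])
  rw [image_id] at hl
  refine ⟨_, hF.inter (hh measurableSet_Iic), hl, u, hu, ?_, fun ω hω => hFu ω hω.1⟩
  refine (Metric.isBounded_closedBall (x := u ω₀) (r := l)).subset ?_
  rintro _ ⟨ω, hω, rfl⟩
  exact Nat.ceil_le.1 hω.2

theorem aemeasurable_iInf_of_polishSpace {β : Type*} [CompleteLinearOrder β] [TopologicalSpace β]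
    [OrderTopology β] [SecondCountableTopology β] [MeasurableSpace β] [BorelSpace β]
    {g : Ω × X → β} (hg : Measurable g) (ν : Measure Ω) [SFinite ν] :
    AEMeasurable (fun ω => ⨅ x, g (ω, x)) ν := by
  have hIio : ∀ c, NullMeasurableSet ((fun ω => ⨅ x, g (ω, x)) ⁻¹' Iio c) ν := fun c => by
    convert nullMeasurableSet_image_fst ν (hg (measurableSet_Iio (a := c))) using 1
    ext ω
    simp [iInf_lt_iff]
  have hnull : NullMeasurable (fun ω => ⨅ x, g (ω, x)) ν :=
    fun _ hs => measurable_of_Iio (δ := NullMeasurableSpace Ω ν) hIio hs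
  exact hnull.aemeasurable

end Selection

section TestSets

variable {Ω : Type*} [MeasurableSpace Ω] {μ : Measure Ω} {A B T : Set Ω} {p : Ω → Prop}

theorem isSigmaFiniteSet_iff_exists_cover :
    IsSigmaFiniteSet μ A ↔ MeasurableSet A ∧
      ∃ C : Set (Set Ω), C.Countable ∧ (∀ S ∈ C, μ S < ∞) ∧ A ⊆ ⋃₀ C := by
  refine and_congr_right fun hA => ⟨fun _ => ?_, fun ⟨C, hC, hfin, hcover⟩ => ?_⟩
  · refine ⟨range fun n => A ∩ spanningSets (μ.restrict A) n, countable_range _, ?_, ?_⟩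
    · rintro _ ⟨n, rfl⟩
      change μ (A ∩ _) < ∞
      rw [inter_comm, ← Measure.restrict_apply' hA]
      exact measure_spanningSets_lt_top _ n
    · rw [sUnion_range, ← inter_iUnion, iUnion_spanningSets, inter_univ]
  · refine Measure.sigmaFinite_of_countable (hC.insert Aᶜ) ?_ (eq_univ_of_forall fun ω => ?_)
    · rintro S (rfl | hS)
      · simp [Measure.restrict_apply hA.compl]
      · exact (Measure.restrict_le_self S).trans_lt (hfin S hS)
    · rw [sUnion_insert]
      exact (em' (ω ∈ A)).imp id (@hcover ω)

theorem isSigmaFiniteSet_of_measure_lt_top (hA : MeasurableSet A) (h : μ A < ∞) :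
    IsSigmaFiniteSet μ A :=
  isSigmaFiniteSet_iff_exists_cover.2 ⟨hA, {A}, countable_singleton A, by simpa, by simp⟩

theorem IsSigmaFiniteSet.iUnion {ι : Type*} [Countable ι] {B : ι → Set Ω}
    (hB : ∀ i, IsSigmaFiniteSet μ (B i)) : IsSigmaFiniteSet μ (⋃ i, B i) := by
  choose hBm C hC hfin hcover using fun i => isSigmaFiniteSet_iff_exists_cover.1 (hB i)
  refine isSigmaFiniteSet_iff_exists_cover.2 ⟨.iUnion hBm, ⋃ i, C i, countable_iUnion hC, ?_, ?_⟩
  · exact fun S hS => (mem_iUnion.1 hS).elim fun i => hfin i S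
  · rw [sUnion_iUnion]
    exact iUnion_mono hcover

theorem IsTestSet.measurableSet (hA : IsTestSet μ A) : MeasurableSet A :=
  hA.elim (·.1) (·.1)

theorem mem_atomSigmaRing_iff : A ∈ atomSigmaRing μ ↔
    ∃ C : Set (Set Ω), C.Countable ∧ (∀ T ∈ C, IsTestSet μ T) ∧ A = ⋃₀ C := by
  constructor
  · rintro ⟨C, hC, hCa, B, hB, rfl⟩
    refine ⟨insert B C, hC.insert B, ?_, by rw [sUnion_insert, union_comm]⟩
    exact forall_mem_insert.2 ⟨.inr hB, fun S hS => .inl (hCa S hS)⟩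
  · rintro ⟨C, hC, hCt, rfl⟩
    have := (hC.mono (sep_subset C (IsSigmaFiniteSet μ))).to_subtype
    refine ⟨{S ∈ C | IsMeasureAtom μ S}, hC.mono (sep_subset _ _), fun S hS => hS.2,
      ⋃₀ {S ∈ C | IsSigmaFiniteSet μ S}, ?_, ?_⟩
    · rw [sUnion_eq_iUnion]
      exact IsSigmaFiniteSet.iUnion fun S => S.2.2
    · rw [← sUnion_union, ← sep_or]
      exact congrArg sUnion (sep_eq_self_iff_mem_true.2 hCt).symm

theorem IsTestSet.mem_atomSigmaRing (hA : IsTestSet μ A) : A ∈ atomSigmaRing μ :=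
  mem_atomSigmaRing_iff.2 ⟨{A}, countable_singleton A, by simpa, by simp⟩

theorem IsSigmaFiniteSet.mem_atomSigmaRing (hA : IsSigmaFiniteSet μ A) : A ∈ atomSigmaRing μ :=
  IsTestSet.mem_atomSigmaRing (.inr hA)

theorem empty_mem_atomSigmaRing : ∅ ∈ atomSigmaRing μ :=
  (isSigmaFiniteSet_of_measure_lt_top .empty (by simp)).mem_atomSigmaRing

theorem measurableSet_of_mem_atomSigmaRing (hA : A ∈ atomSigmaRing μ) : MeasurableSet A := by
  obtain ⟨C, hC, hCt, rfl⟩ := mem_atomSigmaRing_iff.1 hA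
  exact .sUnion hC fun T hT => (hCt T hT).measurableSet

theorem iUnion_mem_atomSigmaRing {ι : Type*} [Countable ι] {A : ι → Set Ω}
    (hA : ∀ i, A i ∈ atomSigmaRing μ) : ⋃ i, A i ∈ atomSigmaRing μ := by
  choose C hC hCt hAC using fun i => mem_atomSigmaRing_iff.1 (hA i)
  refine mem_atomSigmaRing_iff.2 ⟨⋃ i, C i, countable_iUnion hC, fun T hT => ?_, ?_⟩
  · exact (mem_iUnion.1 hT).elim fun i => hCt i T
  · rw [sUnion_iUnion]
    exact iUnion_congr hAC

theorem union_mem_atomSigmaRing (hA : A ∈ atomSigmaRing μ) (hB : B ∈ atomSigmaRing μ) :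
    A ∪ B ∈ atomSigmaRing μ := by
  rw [union_eq_iUnion]
  exact iUnion_mem_atomSigmaRing (Bool.forall_bool.2 ⟨hB, hA⟩)

theorem ae_restrict_of_forall_testSet (hA : A ∈ atomSigmaRing μ)
    (h : ∀ T ⊆ A, IsTestSet μ T → ∀ᵐ ω ∂μ.restrict T, p ω) : ∀ᵐ ω ∂μ.restrict A, p ω := by
  obtain ⟨C, hC, hCt, rfl⟩ := mem_atomSigmaRing_iff.1 hA
  rw [sUnion_eq_biUnion]
  exact (ae_restrict_biUnion_iff _ hC p).2 fun T hT => h T (subset_sUnion_of_mem hT) (hCt T hT)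

theorem aemeasurable_of_forall_testSet {β : Type*} [MeasurableSpace β] {φ : Ω → β}
    (hA : A ∈ atomSigmaRing μ) (h : ∀ T ⊆ A, IsTestSet μ T → AEMeasurable φ (μ.restrict T)) :
    AEMeasurable φ (μ.restrict A) := by
  obtain ⟨C, hC, hCt, rfl⟩ := mem_atomSigmaRing_iff.1 hA
  have := hC.to_subtype
  rw [sUnion_eq_iUnion]
  exact aemeasurable_iUnion_iff.2 fun T => h T (subset_sUnion_of_mem T.2) (hCt T T.2)

theorem intAE_iff_forall_mem_atomSigmaRing :
    IntAE μ p ↔ ∀ A ∈ atomSigmaRing μ, ∀ᵐ ω ∂μ.restrict A, p ω := by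
  have htest : IntAE μ p ↔ ∀ T, IsTestSet μ T → ∀ᵐ ω ∂μ.restrict T, p ω :=
    forall₂_congr fun T hT => by rw [ae_iff, Measure.restrict_apply' hT.measurableSet]
  exact htest.trans ⟨fun h A hA => ae_restrict_of_forall_testSet hA fun T _ => h T,
    fun h T hT => h T hT.mem_atomSigmaRing⟩

theorem exists_isSigmaFiniteSet_subset (hA : A ∈ atomSigmaRing μ) :
    ∃ B ⊆ A, IsSigmaFiniteSet μ B ∧ ∀ p : Ω → Prop,
      (∀ T ⊆ A, IsMeasureAtom μ T → μ T = ∞ → ∀ᵐ ω ∂μ.restrict T, p ω) →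
        ∀ᵐ ω ∂μ.restrict A, ω ∉ B → p ω := by
  obtain ⟨C, hC, hCt, rfl⟩ := mem_atomSigmaRing_iff.1 hA
  let D : Set (Set Ω) := {S ∈ C | IsSigmaFiniteSet μ S}
  have : Countable D := (hC.mono (sep_subset _ _)).to_subtype
  refine ⟨⋃₀ D, sUnion_mono (sep_subset _ _), ?_, fun p hp => ?_⟩
  · rw [sUnion_eq_iUnion]
    exact IsSigmaFiniteSet.iUnion fun S => S.2.2
  rw [sUnion_eq_biUnion (s := C)]
  refine (ae_restrict_biUnion_iff _ hC _).2 fun T hT => ?_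
  by_cases hσ : IsSigmaFiniteSet μ T
  · filter_upwards [ae_restrict_mem (hCt T hT).measurableSet] with ω hω hωD
    exact absurd ⟨T, ⟨hT, hσ⟩, hω⟩ hωD
  · have hatom : IsMeasureAtom μ T := (hCt T hT).resolve_right hσ
    have hinf : μ T = ∞ := by
      by_contra h
      exact hσ (isSigmaFiniteSet_of_measure_lt_top hatom.1 (Ne.lt_top h))
    exact (hp T (subset_sUnion_of_mem hT) hatom hinf).mono fun ω hω _ => hω

theorem IsMeasureAtom.measure_eq_zero_of_lt (hT : IsMeasureAtom μ T) {E : Set Ω}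
    (hE : NullMeasurableSet E (μ.restrict T)) (hlt : μ.restrict T E < μ T) :
    μ.restrict T E = 0 := by
  obtain ⟨E', -, hE', hEE'⟩ := hE.exists_measurable_superset_ae_eq
  rw [← measure_congr hEE', Measure.restrict_apply hE'] at hlt ⊢
  exact (hT.2.2 _ inter_subset_right (hE'.inter hT.1)).resolve_right hlt.ne

theorem IsMeasureAtom.ae_eq_zero_of_lintegral_ne_top (hT : IsMeasureAtom μ T) (hTi : μ T = ∞)
    {φ : Ω → ℝ≥0∞} (hφ : AEMeasurable φ (μ.restrict T)) (hi : ∫⁻ ω in T, φ ω ∂μ ≠ ∞) :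
    φ =ᵐ[μ.restrict T] 0 := by
  have hsuper : ∀ n : ℕ, μ.restrict T {ω | (n : ℝ≥0∞)⁻¹ ≤ φ ω} = 0 := fun n => by
    refine hT.measure_eq_zero_of_lt (nullMeasurableSet_le aemeasurable_const hφ) (hTi ▸ ?_)
    exact ENNReal.lt_top_of_mul_ne_top_right
      (ne_top_of_le_ne_top hi (mul_meas_ge_le_lintegral₀ hφ _)) (by simp)
  refine measure_mono_null (fun ω hω => ?_) (measure_iUnion_null hsuper)
  obtain ⟨n, hn⟩ := ENNReal.exists_inv_nat_lt hω
  exact mem_iUnion.2 ⟨n, hn.le⟩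

end TestSets

section EssInfAttained

variable {Ω : Type*} [MeasurableSpace Ω] {ν : Measure Ω}

/-- `(1 + e^v)⁻¹` is bounded and strictly decreasing, so a member of the family with maximal
integral of `(1 + e^v)⁻¹` with respect to an equivalent finite measure is a least one. -/
theorem exists_forall_ae_le [SFinite ν] {ι : Type*} [Nonempty ι] {v : ι → Ω → EReal}
    (hv : ∀ i, AEMeasurable (v i) ν) (hdir : ∀ s : ℕ → ι, ∃ i, ∀ n, v i ≤ᵐ[ν] v (s n)) :
    ∃ i, ∀ j, v i ≤ᵐ[ν] v j := by
  let ψ : EReal → ℝ≥0∞ := fun y => (1 + y.exp)⁻¹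
  have hψ : StrictAnti ψ := fun x y hxy => ENNReal.inv_strictAnti <|
    ENNReal.add_lt_add_left ENNReal.one_ne_top (EReal.exp_strictMono hxy)
  have hψ1 : ∀ y, ψ y ≤ 1 := fun y => ENNReal.inv_le_one.2 le_self_add
  have hψm : ∀ i, AEMeasurable (fun ω => ψ (v i ω)) ν.toFinite := fun i =>
    ((EReal.measurable_exp.comp_aemeasurable
      ((hv i).mono_ac (toFinite_absolutelyContinuous ν))).const_add 1).inv
  have hψfin : ∀ i, ∫⁻ ω, ψ (v i ω) ∂ν.toFinite ≠ ∞ := fun i =>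
    ((lintegral_mono fun ω => hψ1 (v i ω)).trans_lt (by simp)).ne
  have hmono : ∀ {i j}, v i ≤ᵐ[ν] v j →
      (fun ω => ψ (v j ω)) ≤ᵐ[ν.toFinite] fun ω => ψ (v i ω) := fun h =>
    (toFinite_absolutelyContinuous ν).ae_le (h.mono fun ω hω => hψ.antitone hω)
  obtain ⟨i, hi⟩ := exists_forall_le_of_countablyDirected
    (Φ := fun i => ∫⁻ ω, ψ (v i ω) ∂ν.toFinite) fun s =>
      (hdir s).imp fun i hi n => lintegral_mono_ae (hmono (hi n))
  refine ⟨i, fun j => ?_⟩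
  obtain ⟨k, hk⟩ := hdir fun n => if n = 0 then i else j
  have hki : v k ≤ᵐ[ν] v i := hk 0
  have hkj : v k ≤ᵐ[ν] v j := hk 1
  have heq := (absolutelyContinuous_toFinite ν).ae_le <|
    ae_eq_of_ae_le_of_lintegral_le (hmono hki) (hψfin i) (hψm k) (hi k)
  filter_upwards [heq, hkj] with ω h₁ h₂
  exact (hψ.injective h₁).trans_le h₂

end EssInfAttained

section ExhaustingIntegral

variable {Ω β : Type*} [MeasurableSpace Ω] [MeasurableSpace β] {μ : Measure Ω}

/-- A family of functions `α A`, for `A` in the `σ`-ring of countable unions of atoms and a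
`σ`-finite set, such that `α A` is measurable for the completion on `A` and any two members agree
almost everywhere on their common domain; the latter need only be required for nested domains. -/
structure IsExhaustingFamily (μ : Measure Ω) (α : Set Ω → Ω → β) : Prop where
  aemeasurable : ∀ A ∈ atomSigmaRing μ, AEMeasurable (α A) (μ.restrict A)
  ae_eq_of_subset : ∀ A ∈ atomSigmaRing μ, ∀ B ∈ atomSigmaRing μ, A ⊆ B →
    α A =ᵐ[μ.restrict A] α B

theorem isExhaustingFamily_const_iff {φ : Ω → β} : IsExhaustingFamily μ (fun _ => φ) ↔
    ∀ A ∈ atomSigmaRing μ, AEMeasurable φ (μ.restrict A) :=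
  ⟨fun h => h.aemeasurable, fun h => ⟨h, fun _ _ _ _ _ => .rfl⟩⟩

theorem IsExhaustingFamily.comp {γ : Type*} [MeasurableSpace γ] {α : Set Ω → Ω → β}
    (hα : IsExhaustingFamily μ α) {g : β → γ} (hg : Measurable g) :
    IsExhaustingFamily μ fun A ω => g (α A ω) :=
  ⟨fun A hA => hg.comp_aemeasurable (hα.aemeasurable A hA),
    fun A hA B hB hAB => (hα.ae_eq_of_subset A hA B hB hAB).fun_comp g⟩

theorem IsExhaustingFamily.prodMk {γ : Type*} [MeasurableSpace γ] {α : Set Ω → Ω → β}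
    {α' : Set Ω → Ω → γ} (hα : IsExhaustingFamily μ α) (hα' : IsExhaustingFamily μ α') :
    IsExhaustingFamily μ fun A ω => (α A ω, α' A ω) :=
  ⟨fun A hA => (hα.aemeasurable A hA).prodMk (hα'.aemeasurable A hA), fun A hA B hB hAB =>
    (hα.ae_eq_of_subset A hA B hB hAB).prodMk (hα'.ae_eq_of_subset A hA B hB hAB)⟩

/-- The exhausting integral of a family of `[0, ∞]`-valued functions. -/
noncomputable def exhLIntegral (μ : Measure Ω) (φ : Set Ω → Ω → ℝ≥0∞) : ℝ≥0∞ :=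
  ⨆ A ∈ atomSigmaRing μ, ∫⁻ ω in A, φ A ω ∂μ

variable {φ ψ : Set Ω → Ω → ℝ≥0∞} {A : Set Ω}

theorem setLIntegral_le_exhLIntegral (hA : A ∈ atomSigmaRing μ) :
    ∫⁻ ω in A, φ A ω ∂μ ≤ exhLIntegral μ φ :=
  le_iSup₂ (f := fun A (_ : A ∈ atomSigmaRing μ) => ∫⁻ ω in A, φ A ω ∂μ) A hA

theorem exhLIntegral_mono (h : ∀ A ∈ atomSigmaRing μ, φ A ≤ᵐ[μ.restrict A] ψ A) :
    exhLIntegral μ φ ≤ exhLIntegral μ ψ :=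
  iSup₂_mono fun A hA => lintegral_mono_ae (h A hA)

theorem IsExhaustingFamily.setLIntegral_mono (hφ : IsExhaustingFamily μ φ) {B : Set Ω}
    (hA : A ∈ atomSigmaRing μ) (hB : B ∈ atomSigmaRing μ) (hAB : A ⊆ B) :
    ∫⁻ ω in A, φ A ω ∂μ ≤ ∫⁻ ω in B, φ B ω ∂μ :=
  (lintegral_congr_ae (hφ.ae_eq_of_subset A hA B hB hAB)).trans_le (lintegral_mono_set hAB)

theorem IsExhaustingFamily.exists_superset_forall_setLIntegral_eq (hφ : IsExhaustingFamily μ φ)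
    (hA : A ∈ atomSigmaRing μ) : ∃ B ∈ atomSigmaRing μ, A ⊆ B ∧
      ∀ C ∈ atomSigmaRing μ, B ⊆ C → ∫⁻ ω in C, φ C ω ∂μ = exhLIntegral μ φ := by
  have : Nonempty (atomSigmaRing μ) := ⟨A, hA⟩
  obtain ⟨⟨B, hB⟩, hmax⟩ := exists_forall_le_of_countablyDirected (ι := atomSigmaRing μ)
    (Φ := fun B => ∫⁻ ω in (B : Set Ω), φ B ω ∂μ) fun s =>
      ⟨⟨⋃ n, s n, iUnion_mem_atomSigmaRing fun n => (s n).2⟩, fun n =>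
        hφ.setLIntegral_mono (s n).2 (iUnion_mem_atomSigmaRing fun n => (s n).2)
          (subset_iUnion (fun n => (s n : Set Ω)) n)⟩
  refine ⟨A ∪ B, union_mem_atomSigmaRing hA hB, subset_union_left, fun C hC hBC => ?_⟩
  exact (setLIntegral_le_exhLIntegral hC).antisymm <| iSup₂_le fun D hD =>
    (hmax ⟨D, hD⟩).trans (hφ.setLIntegral_mono hB hC (subset_union_right.trans hBC))

theorem exhLIntegral_add (hφ : IsExhaustingFamily μ φ) (hψ : IsExhaustingFamily μ ψ) :
    exhLIntegral μ (fun A ω => φ A ω + ψ A ω) = exhLIntegral μ φ + exhLIntegral μ ψ := by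
  have hsum : IsExhaustingFamily μ fun A ω => φ A ω + ψ A ω := (hφ.prodMk hψ).comp measurable_add
  obtain ⟨A, hA, -, hAφ⟩ := hφ.exists_superset_forall_setLIntegral_eq empty_mem_atomSigmaRing
  obtain ⟨B, hB, hAB, hBψ⟩ := hψ.exists_superset_forall_setLIntegral_eq hA
  obtain ⟨C, hC, hBC, hCsum⟩ := hsum.exists_superset_forall_setLIntegral_eq hB
  rw [← hCsum C hC subset_rfl, ← hAφ C hC (hAB.trans hBC), ← hBψ C hC hBC,
    lintegral_add_left' (hφ.aemeasurable C hC)]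

theorem IsExhaustingFamily.exists_forall_ae_notMem_eq_zero (hφ : IsExhaustingFamily μ φ)
    (hfin : exhLIntegral μ φ ≠ ∞) : ∃ A ∈ atomSigmaRing μ, ∀ B ∈ atomSigmaRing μ,
      ∀ᵐ ω ∂μ.restrict B, ω ∉ A → φ B ω = 0 := by
  obtain ⟨A, hA, -, hAmax⟩ := hφ.exists_superset_forall_setLIntegral_eq empty_mem_atomSigmaRing
  refine ⟨A, hA, fun B hB => ?_⟩
  have hAm := measurableSet_of_mem_atomSigmaRing hA
  have hBm := measurableSet_of_mem_atomSigmaRing hB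
  have hAB := union_mem_atomSigmaRing hA hB
  have hφB := hφ.ae_eq_of_subset B hB _ hAB subset_union_right
  have hdiff : ∫⁻ ω in B \ A, φ (A ∪ B) ω ∂μ = 0 := by
    have hsplit : ∫⁻ ω in A, φ (A ∪ B) ω ∂μ + ∫⁻ ω in B \ A, φ (A ∪ B) ω ∂μ
        = exhLIntegral μ φ := by
      rw [← lintegral_union (hBm.diff hAm) disjoint_sdiff_right, union_sdiff_self,
        hAmax _ hAB subset_union_left]
    rw [← lintegral_congr_ae (hφ.ae_eq_of_subset A hA _ hAB subset_union_left),
      hAmax A hA subset_rfl] at hsplit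
    exact (ENNReal.add_right_inj hfin).1 (hsplit.trans (add_zero _).symm)
  have hzero := (lintegral_eq_zero_iff' ((hφ.aemeasurable _ hAB).mono_measure
    (Measure.restrict_mono_set μ (sdiff_subset.trans subset_union_right)))).1 hdiff
  rw [Filter.EventuallyEq, ae_restrict_iff' (hBm.diff hAm)] at hzero
  filter_upwards [hφB, ae_restrict_of_ae hzero, ae_restrict_mem hBm] with ω h₁ h₂ hωB hωA
  exact h₁.trans (h₂ ⟨hωB, hωA⟩)

theorem ae_eq_of_exhLIntegral_le (hφ : IsExhaustingFamily μ φ) (hψ : IsExhaustingFamily μ ψ)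
    (hle : ∀ A ∈ atomSigmaRing μ, φ A ≤ᵐ[μ.restrict A] ψ A)
    (hfin : exhLIntegral μ φ ≠ ∞) (h : exhLIntegral μ ψ ≤ exhLIntegral μ φ)
    (hA : A ∈ atomSigmaRing μ) : φ A =ᵐ[μ.restrict A] ψ A := by
  obtain ⟨B, hB, hAB, hBmax⟩ := hφ.exists_superset_forall_setLIntegral_eq hA
  have hint : ∫⁻ ω in B, φ B ω ∂μ = exhLIntegral μ φ := hBmax B hB subset_rfl
  have heq : φ B =ᵐ[μ.restrict B] ψ B := ae_eq_of_ae_le_of_lintegral_le (hle B hB)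
    (hint ▸ hfin) (hψ.aemeasurable B hB) ((setLIntegral_le_exhLIntegral hB).trans (hint ▸ h))
  exact ((hφ.ae_eq_of_subset A hA B hB hAB).trans
    (ae_mono (Measure.restrict_mono_set μ hAB) heq)).trans
      (hψ.ae_eq_of_subset A hA B hB hAB).symm

variable {α α' : Set Ω → Ω → EReal}

theorem exhIntegralFamily_of_ne_top
    (h : exhLIntegral μ (fun A ω => (α A ω).toENNReal) ≠ ∞) :
    exhIntegralFamily μ α = exhLIntegral μ (fun A ω => (α A ω).toENNReal) -
      (exhLIntegral μ (fun A ω => (-α A ω).toENNReal) : EReal) :=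
  if_neg h

theorem exhIntegralFamily_le_exhLIntegral_toENNReal :
    exhIntegralFamily μ α ≤ exhLIntegral μ fun A ω => (α A ω).toENNReal := by
  by_cases h : exhLIntegral μ (fun A ω => (α A ω).toENNReal) = ∞
  · simp [h]
  · rw [exhIntegralFamily_of_ne_top h]
    exact EReal.sub_le_of_le_add' (le_add_of_nonneg_left (EReal.coe_ennreal_nonneg _))

theorem exhIntegralFamily_ne_top_iff :
    exhIntegralFamily μ α ≠ ⊤ ↔ exhLIntegral μ (fun A ω => (α A ω).toENNReal) ≠ ∞ :=
  ⟨mt fun h => if_pos h, fun h => ne_top_of_le_ne_top (EReal.coe_ennreal_eq_top_iff.not.2 h)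
    exhIntegralFamily_le_exhLIntegral_toENNReal⟩

theorem exhIntegralFamily_mono (h : ∀ A ∈ atomSigmaRing μ, α A ≤ᵐ[μ.restrict A] α' A) :
    exhIntegralFamily μ α ≤ exhIntegralFamily μ α' := by
  have hpos : exhLIntegral μ (fun A ω => (α A ω).toENNReal) ≤
      exhLIntegral μ fun A ω => (α' A ω).toENNReal :=
    exhLIntegral_mono fun A hA => (h A hA).mono fun ω => EReal.toENNReal_le_toENNReal
  have hneg : exhLIntegral μ (fun A ω => (-α' A ω).toENNReal) ≤
      exhLIntegral μ fun A ω => (-α A ω).toENNReal :=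
    exhLIntegral_mono fun A hA => (h A hA).mono fun ω hω =>
      EReal.toENNReal_le_toENNReal (EReal.neg_le_neg_iff.2 hω)
  by_cases hα' : exhLIntegral μ (fun A ω => (α' A ω).toENNReal) = ∞
  · exact le_top.trans_eq (if_pos hα').symm
  rw [exhIntegralFamily_of_ne_top (ne_top_of_le_ne_top hα' hpos),
    exhIntegralFamily_of_ne_top hα']
  exact EReal.sub_le_sub (EReal.coe_ennreal_le_coe_ennreal_iff.2 hpos)
    (EReal.coe_ennreal_le_coe_ennreal_iff.2 hneg)

theorem exhIntegralFamily_congr (h : ∀ A ∈ atomSigmaRing μ, α A =ᵐ[μ.restrict A] α' A) :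
    exhIntegralFamily μ α = exhIntegralFamily μ α' :=
  (exhIntegralFamily_mono fun A hA => (h A hA).le).antisymm
    (exhIntegralFamily_mono fun A hA => (h A hA).symm.le)

theorem exhLIntegral_toENNReal_neg_ne_top (htop : exhIntegralFamily μ α ≠ ⊤)
    (hbot : exhIntegralFamily μ α ≠ ⊥) :
    exhLIntegral μ (fun A ω => (-α A ω).toENNReal) ≠ ∞ := by
  intro h
  have hpos := exhIntegralFamily_ne_top_iff.1 htop
  rw [exhIntegralFamily_of_ne_top hpos, h, EReal.coe_ennreal_top] at hbot
  exact hbot (EReal.sub_top _)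

theorem IsExhaustingFamily.exists_forall_ae_notMem_le_zero_le (hα : IsExhaustingFamily μ α)
    (hα' : IsExhaustingFamily μ α') (htop : exhIntegralFamily μ α ≠ ⊤)
    (htop' : exhIntegralFamily μ α' ≠ ⊤) (hbot' : exhIntegralFamily μ α' ≠ ⊥) :
    ∃ A ∈ atomSigmaRing μ, ∀ B ∈ atomSigmaRing μ,
      ∀ᵐ ω ∂μ.restrict B, ω ∉ A → α B ω ≤ 0 ∧ 0 ≤ α' B ω := by
  have hpos := hα.comp measurable_ereal_toENNReal
  have hneg := hα'.comp (g := fun y => (-y).toENNReal) (by fun_prop)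
  have hfin : exhLIntegral μ (fun A ω => (α A ω).toENNReal + (-α' A ω).toENNReal) ≠ ∞ := by
    rw [exhLIntegral_add hpos hneg]
    exact ENNReal.add_ne_top.2 ⟨exhIntegralFamily_ne_top_iff.1 htop,
      exhLIntegral_toENNReal_neg_ne_top htop' hbot'⟩
  obtain ⟨A, hA, hzero⟩ :=
    ((hpos.prodMk hneg).comp measurable_add).exists_forall_ae_notMem_eq_zero hfin
  refine ⟨A, hA, fun B hB => (hzero B hB).mono fun ω hω hωA => ?_⟩
  obtain ⟨hωpos, hωneg⟩ := add_eq_zero.1 (hω hωA)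
  exact ⟨EReal.toENNReal_eq_zero_iff.1 hωpos,
    EReal.neg_le_zero.1 (EReal.toENNReal_eq_zero_iff.1 hωneg)⟩

/-- A family with finite exhausting integral vanishes off one set `A`, so that the function equal
to `α A` on `A` and to `0` elsewhere represents the whole family. -/
theorem IsExhaustingFamily.exists_aemeasurable_forall_ae_eq (hα : IsExhaustingFamily μ α)
    (htop : exhIntegralFamily μ α ≠ ⊤) (hbot : exhIntegralFamily μ α ≠ ⊥) :
    ∃ m : Ω → EReal, AEMeasurable m μ ∧ ∀ A ∈ atomSigmaRing μ, α A =ᵐ[μ.restrict A] m := by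
  obtain ⟨A, hA, hzero⟩ := hα.exists_forall_ae_notMem_le_zero_le hα htop htop hbot
  have hAm := measurableSet_of_mem_atomSigmaRing hA
  refine ⟨A.indicator (α A), (aemeasurable_indicator_iff hAm).2 (hα.aemeasurable A hA),
    fun B hB => ?_⟩
  have hAB := union_mem_atomSigmaRing hA hB
  have honA := (ae_restrict_iff' hAm).1 (hα.ae_eq_of_subset A hA _ hAB subset_union_left)
  filter_upwards [hα.ae_eq_of_subset B hB _ hAB subset_union_right, ae_restrict_of_ae honA,
    hzero B hB] with ω h₁ h₂ h₃
  by_cases hω : ω ∈ A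
  · rw [indicator_of_mem hω, h₁, h₂ hω]
  · rw [indicator_of_notMem hω]
    exact (h₃ hω).1.antisymm (h₃ hω).2

end ExhaustingIntegral

section Gap

/-- The amount by which `v` lies below the bound `p`. It is zero if `p ≤ v`, even for
`p = v = ∞`. -/
noncomputable def gap (p : ℝ≥0∞) (v : EReal) : ℝ≥0∞ := ((p : EReal) - v).toENNReal

theorem gap_antitone (p : ℝ≥0∞) : Antitone (gap p) := fun _ _ h =>
  EReal.toENNReal_le_toENNReal (EReal.sub_le_sub le_rfl h)

theorem measurable_gap : Measurable fun q : ℝ≥0∞ × EReal => gap q.1 q.2 :=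
  (measurable_fst.coe_ereal_ennreal.sub measurable_snd).ereal_toENNReal

theorem lt_of_gap_pos {p : ℝ≥0∞} {v : EReal} (h : 0 < gap p v) : v < p :=
  EReal.sub_pos.1 (EReal.toENNReal_pos_iff.1 h)

theorem gap_zero_of_nonneg {v : EReal} (hv : 0 ≤ v) : gap 0 v = 0 :=
  EReal.toENNReal_of_nonpos (by simpa using hv)

theorem gap_add_toENNReal {p : ℝ≥0∞} {v : EReal} (h : v ≤ p) :
    gap p v + v.toENNReal = p + (-v).toENNReal := by
  rcases le_total 0 v with hv | hv
  · rw [gap, EReal.toENNReal_sub hv, EReal.toENNReal_coe, tsub_add_cancel_of_le,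
      EReal.toENNReal_of_nonpos (EReal.neg_le_zero.2 hv), add_zero]
    exact (EReal.toENNReal_le_toENNReal h).trans_eq EReal.toENNReal_coe
  · rw [gap, sub_eq_add_neg, EReal.toENNReal_add (EReal.coe_ennreal_nonneg p)
      (EReal.neg_nonneg.2 hv), EReal.toENNReal_coe, EReal.toENNReal_of_nonpos hv, add_zero]

theorem le_coe_toENNReal (v : EReal) : v ≤ v.toENNReal :=
  (le_max_right _ _).trans_eq EReal.coe_toENNReal_eq_max.symm

theorem gap_iInf {ι : Sort*} {p : ℝ≥0∞} (hp : p ≠ ∞) (v : ι → EReal) :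
    gap p (⨅ i, v i) = ⨆ i, gap p (v i) := by
  refine (gap_antitone p).map_iInf_of_continuousAt ?_ (by simp [gap])
  have hsub : ContinuousAt (fun x : EReal => (p : EReal) + -x) (⨅ i, v i) :=
    (EReal.continuousAt_add (.inl (EReal.coe_ennreal_eq_top_iff.not.2 hp))
      (.inl (EReal.coe_ennreal_ne_bot p))).comp (f := fun x : EReal => ((p : EReal), -x))
      (by fun_prop)
  exact EReal.continuous_toENNReal.continuousAt.comp hsub

theorem coe_ennreal_sub_injective {p : ℝ≥0∞} (hp : p ≠ ∞) :
    Function.Injective fun x : EReal => (p : EReal) - x := by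
  lift p to NNReal using hp
  refine Function.LeftInverse.injective (g := fun x => ((p : ℝ) : EReal) - x) fun x => ?_
  change ((p : ℝ) : EReal) - ((p : ℝ) - x) = x
  induction x <;> simp [← EReal.coe_sub]

theorem le_coe_ennreal_sub_of_forall_lt {p y : ℝ≥0∞} {c : EReal} (hp : p ≠ ∞) (hc : c ≤ p)
    (h : ∀ L < y, c ≤ (p : EReal) - L) : c ≤ (p : EReal) - y := by
  have hp' : (p : EReal) ≠ ⊤ := EReal.coe_ennreal_eq_top_iff.not.2 hp
  have hswap : ∀ L : ℝ≥0∞, c ≤ (p : EReal) - L ↔ (L : EReal) ≤ p - c := fun L => by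
    rw [EReal.le_sub_iff_add_le (.inl (EReal.coe_ennreal_ne_bot L)) (.inr hp'),
      EReal.le_sub_iff_add_le (.inr (EReal.coe_ennreal_ne_bot p)) (.inr hp'), add_comm]
  have hcoe : ∀ L : ℝ≥0∞, (L : EReal) ≤ p - c ↔ L ≤ ((p : EReal) - c).toENNReal := fun L => by
    rw [← EReal.coe_ennreal_le_coe_ennreal_iff, EReal.coe_toENNReal
      ((EReal.sub_nonneg (.inl hp') (.inl (EReal.coe_ennreal_ne_bot p))).2 hc)]
  simp only [hswap, hcoe] at h ⊢
  exact le_of_forall_lt_imp_le_of_dense h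

theorem gap_injOn {p : ℝ≥0∞} (hp : p ≠ ∞) : InjOn (gap p) (Iic (p : EReal)) := by
  have hnonneg : ∀ v ∈ Iic (p : EReal), 0 ≤ (p : EReal) - v := fun v hv =>
    (EReal.sub_nonneg (.inl (EReal.coe_ennreal_eq_top_iff.not.2 hp))
      (.inl (EReal.coe_ennreal_ne_bot p))).2 hv
  exact fun v hv w hw h => coe_ennreal_sub_injective hp <|
    (EReal.toENNReal_eq_toENNReal (hnonneg v hv) (hnonneg w hw)).1 h

variable {Ω : Type*} [MeasurableSpace Ω] {μ : Measure Ω} {p : Set Ω → Ω → ℝ≥0∞}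
  {α α' : Set Ω → Ω → EReal} {A : Set Ω}

theorem IsExhaustingFamily.gap (hp : IsExhaustingFamily μ p) (hα : IsExhaustingFamily μ α) :
    IsExhaustingFamily μ fun A ω => gap (p A ω) (α A ω) :=
  (hp.prodMk hα).comp measurable_gap

theorem ae_ne_top_of_exhLIntegral_ne_top (hp : IsExhaustingFamily μ p)
    (hfin : exhLIntegral μ p ≠ ∞) (hA : A ∈ atomSigmaRing μ) :
    ∀ᵐ ω ∂μ.restrict A, p A ω ≠ ∞ :=
  (ae_lt_top' (hp.aemeasurable A hA)
    (ne_top_of_le_ne_top hfin (setLIntegral_le_exhLIntegral hA))).mono fun _ => LT.lt.ne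

theorem coe_ennreal_sub_eq_sub {p q x y : ℝ≥0∞} (hp : p ≠ ∞) (hq : q ≠ ∞)
    (h : x + p = q + y) : (p : EReal) - y = q - x := by
  lift p to NNReal using hp
  lift q to NNReal using hq
  rcases eq_or_ne y ∞ with rfl | hy
  · obtain rfl : x = ∞ := by simpa using h
    simp [EReal.sub_top]
  · have hx : x ≠ ∞ := ne_top_of_le_ne_top (by finiteness) (le_self_add.trans_eq h)
    lift x to NNReal using hx
    lift y to NNReal using hy
    have h' : (x + p : ℝ) = q + y := by exact_mod_cast h
    have : (p - y : ℝ) = q - x := by linarith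
    exact congrArg Real.toEReal this

/-- Below an integrable bound `p` the exhausting integral is governed by the single nonnegative
family `gap p α`, which avoids the difference of suprema in its definition. -/
theorem exhIntegralFamily_eq_sub_exhLIntegral_gap (hp : IsExhaustingFamily μ p)
    (hα : IsExhaustingFamily μ α) (hfin : exhLIntegral μ p ≠ ∞)
    (hle : ∀ A ∈ atomSigmaRing μ, ∀ᵐ ω ∂μ.restrict A, α A ω ≤ p A ω) :
    exhIntegralFamily μ α =
      exhLIntegral μ p - (exhLIntegral μ fun A ω => gap (p A ω) (α A ω) : EReal) := by
  have hpos := hα.comp measurable_ereal_toENNReal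
  have hneg := hα.comp (g := fun y => (-y).toENNReal) (by fun_prop)
  have hPfin : exhLIntegral μ (fun A ω => (α A ω).toENNReal) ≠ ∞ :=
    ne_top_of_le_ne_top hfin <| exhLIntegral_mono fun A hA => (hle A hA).mono fun ω hω =>
      (EReal.toENNReal_le_toENNReal hω).trans_eq EReal.toENNReal_coe
  rw [exhIntegralFamily_of_ne_top hPfin]
  refine coe_ennreal_sub_eq_sub hPfin hfin ?_
  rw [← exhLIntegral_add (hp.gap hα) hpos, ← exhLIntegral_add hp hneg]
  have heq : ∀ A ∈ atomSigmaRing μ, (fun ω => gap (p A ω) (α A ω) + (α A ω).toENNReal)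
      =ᵐ[μ.restrict A] fun ω => p A ω + (-α A ω).toENNReal := fun A hA =>
    (hle A hA).mono fun _ hω => gap_add_toENNReal hω
  exact (exhLIntegral_mono fun A hA => (heq A hA).le).antisymm
    (exhLIntegral_mono fun A hA => (heq A hA).symm.le)

theorem ae_eq_of_exhIntegralFamily_eq (hα : IsExhaustingFamily μ α)
    (hα' : IsExhaustingFamily μ α') (hle : ∀ A ∈ atomSigmaRing μ, α A ≤ᵐ[μ.restrict A] α' A)
    (h : exhIntegralFamily μ α = exhIntegralFamily μ α') (htop : exhIntegralFamily μ α ≠ ⊤)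
    (hbot : exhIntegralFamily μ α ≠ ⊥) (hA : A ∈ atomSigmaRing μ) :
    α A =ᵐ[μ.restrict A] α' A := by
  set p : Set Ω → Ω → ℝ≥0∞ := fun A ω => (α' A ω).toENNReal
  have hp : IsExhaustingFamily μ p := hα'.comp measurable_ereal_toENNReal
  have hfin : exhLIntegral μ p ≠ ∞ := exhIntegralFamily_ne_top_iff.1 (h ▸ htop)
  have hα'p : ∀ A ω, α' A ω ≤ p A ω := fun A ω => le_coe_toENNReal (α' A ω)
  have hαp : ∀ A ∈ atomSigmaRing μ, ∀ᵐ ω ∂μ.restrict A, α A ω ≤ p A ω := fun A hA =>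
    (hle A hA).mono fun ω hω => hω.trans (hα'p A ω)
  rw [exhIntegralFamily_eq_sub_exhLIntegral_gap hp hα hfin hαp] at h hbot
  rw [exhIntegralFamily_eq_sub_exhLIntegral_gap hp hα' hfin fun A _ => ae_of_all _ (hα'p A)] at h
  have hgap : ∀ A ∈ atomSigmaRing μ, (fun ω => gap (p A ω) (α' A ω)) ≤ᵐ[μ.restrict A]
      fun ω => gap (p A ω) (α A ω) := fun A hA =>
    (hle A hA).mono fun ω hω => gap_antitone _ hω
  have hgap_fin : exhLIntegral μ (fun A ω => gap (p A ω) (α A ω)) ≠ ∞ := fun htop => by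
    rw [htop, EReal.coe_ennreal_top] at hbot
    exact hbot (EReal.sub_top _)
  have hgap_eq : exhLIntegral μ (fun A ω => gap (p A ω) (α A ω)) =
      exhLIntegral μ fun A ω => gap (p A ω) (α' A ω) :=
    EReal.coe_ennreal_injective (coe_ennreal_sub_injective hfin h)
  filter_upwards [ae_eq_of_exhLIntegral_le (hp.gap hα') (hp.gap hα) hgap (hgap_eq ▸ hgap_fin)
    hgap_eq.le hA, hαp A hA, ae_ne_top_of_exhLIntegral_ne_top hp hfin hA] with ω h₁ h₂ h₃
  exact gap_injOn h₃ h₂ (hα'p A ω) h₁.symm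

end Gap

section Decomposable

variable {Ω : Type*} [MeasurableSpace Ω] {μ ν : Measure Ω} {L : ℝ≥0∞}

theorem exists_measurable_lt_lintegral [SigmaFinite ν] {φ : Ω → ℝ≥0∞} (hL : L < ∫⁻ ω, φ ω ∂ν) :
    ∃ t : Ω → ℝ≥0∞, Measurable t ∧ (∀ ω, t ω ≠ 0 → t ω < φ ω) ∧ ν (Function.support t) < ∞ ∧
      ∫⁻ ω, t ω ∂ν ≠ ∞ ∧ L < ∫⁻ ω, t ω ∂ν := by
  simp_rw [lintegral_eq_nnreal, lt_iSup_iff] at hL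
  obtain ⟨g, hgφ, hg⟩ := hL
  rw [← SimpleFunc.lintegral_eq_lintegral] at hg
  obtain ⟨s, hsg, hsfin, hs⟩ := SimpleFunc.exists_lt_lintegral_simpleFunc_of_lt_lintegral
    (f := g) (by simpa using hg)
  have hs0 : ∫⁻ ω, s ω ∂ν ≠ 0 := hs.ne_bot
  obtain ⟨c, hLc, hc⟩ := exists_between
    ((ENNReal.div_lt_iff (.inl hs0) (.inl hsfin.ne)).2 (by rwa [one_mul]) :
      L / ∫⁻ ω, s ω ∂ν < 1)
  have hc0 : c ≠ 0 := hLc.ne_bot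
  have hint : ∫⁻ ω, c * s ω ∂ν = c * ∫⁻ ω, s ω ∂ν := lintegral_const_mul' _ _ hc.ne_top
  have hsupp : (Function.support fun ω => c * (s ω : ℝ≥0∞)) = Function.support s := by
    ext ω
    simp [hc0]
  refine ⟨fun ω => c * s ω, by fun_prop, fun ω hω => ?_, ?_, ?_, ?_⟩
  · have hs0 : (s ω : ℝ≥0∞) ≠ 0 := right_ne_zero_of_mul hω
    calc c * s ω < 1 * s ω := ENNReal.mul_lt_mul_left hs0 ENNReal.coe_ne_top hc
      _ ≤ g ω := by simpa using hsg ω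
      _ ≤ φ ω := hgφ ω
  · rw [hsupp]
    have := SimpleFunc.measure_support_lt_top_of_lintegral_ne_top (μ := ν)
      (f := s.map ((↑) : NNReal → ℝ≥0∞)) (by
        rw [← SimpleFunc.lintegral_eq_lintegral]
        simpa using hsfin.ne)
    exact (measure_mono fun ω hω => by simpa using hω).trans_lt this
  · exact hint ▸ ENNReal.mul_ne_top hc.ne_top hsfin.ne
  · exact hint ▸ (ENNReal.div_lt_iff (.inl hs0) (.inl hsfin.ne)).1 hLc

theorem exists_pos_forall_lt_setLIntegral_of_measure_diff_lt {t : Ω → ℝ≥0∞} {F : Set Ω}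
    (hfin : ∫⁻ ω in F, t ω ∂μ ≠ ∞) (hL : L < ∫⁻ ω in F, t ω ∂μ) :
    ∃ δ > 0, ∀ G ⊆ F, MeasurableSet G → μ (F \ G) < δ → L < ∫⁻ ω in G, t ω ∂μ := by
  obtain ⟨δ, hδ, h⟩ := exists_pos_setLIntegral_lt_of_measure_lt hfin (tsub_pos_of_lt hL).ne'
  refine ⟨δ, hδ, fun G hGF hG hFG => ?_⟩
  have hsmall := h (F \ G) ((Measure.restrict_apply_le _ _).trans_lt hFG)
  rw [Measure.restrict_restrict_of_subset sdiff_subset, lt_tsub_iff_right] at hsmall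
  rw [← lintegral_inter_add_sdiff t F hG, inter_eq_self_of_subset_right hGF,
    add_comm (∫⁻ ω in G, t ω ∂μ)] at hsmall
  exact lt_of_add_lt_add_left hsmall

theorem exists_measurable_bounded_selection_measure_diff_lt {X : Type*} [MetricSpace X]
    [PolishSpace X] [MeasurableSpace X] [BorelSpace X] {F : Set Ω} (hF : MeasurableSet F)
    (hμF : μ F < ∞) (hμF0 : μ F ≠ 0) {S : Set (Ω × X)} (hS : MeasurableSet S)
    (hFS : F ⊆ Prod.fst '' S) {ε : ℝ≥0∞} (hε : 0 < ε) :
    ∃ E ⊆ F, MeasurableSet E ∧ μ (F \ E) < ε ∧ ∃ u : Ω → X, Measurable u ∧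
      Bornology.IsBounded (u '' E) ∧ ∀ ω ∈ E, (ω, u ω) ∈ S := by
  have : IsFiniteMeasure (μ.restrict F) := ⟨by simpa using hμF⟩
  obtain ⟨E, hE, hEμ, u, hu, hbdd, hsel⟩ := exists_measurable_bounded_selection (μ.restrict F)
    hS (c := μ F - ε) (by
      rw [Measure.restrict_apply_superset hFS]
      exact ENNReal.sub_lt_self hμF.ne hμF0 hε.ne')
  refine ⟨F ∩ E, inter_subset_left, hF.inter hE, ?_, u, hu,
    hbdd.subset (image_mono inter_subset_right), fun ω hω => hsel ω hω.2⟩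
  rw [Measure.restrict_apply hE, inter_comm] at hEμ
  rw [sdiff_self_inter]
  refine lt_of_add_lt_add_right (a := μ (F ∩ E)) ?_
  rw [measure_sdiff_add_inter F hE, add_comm]
  exact ENNReal.lt_add_of_sub_lt_right (.inl hμF.ne) hEμ

open Classical in
theorem AlmostDecomposable.exists_lt_setLIntegral {M : Type*} [MetricSpace M] [MeasurableSpace M]
    [BorelSpace M] {R : Set (Ω → M)} (hdec : AlmostDecomposable μ R) {u₀ : Ω → M} (hu₀ : u₀ ∈ R)
    {W : Set M} [PolishSpace W] {Φ : Ω × W → ℝ≥0∞} (hΦ : Measurable Φ) {B : Set Ω}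
    (hB : IsSigmaFiniteSet μ B) (hL : L < ∫⁻ ω in B, ⨆ x, Φ (ω, x) ∂μ) :
    ∃ G ⊆ B, MeasurableSet G ∧ ∃ u₁ : Ω → W, (G.piecewise (fun ω => (u₁ ω : M)) u₀ ∈ R) ∧
      (∀ ω ∈ G, 0 < Φ (ω, u₁ ω)) ∧ L < ∫⁻ ω in G, Φ (ω, u₁ ω) ∂μ := by
  have := hB.2
  obtain ⟨t, ht, htΦ, hsupp, hfin, hLt⟩ := exists_measurable_lt_lintegral hL
  let F : Set Ω := Function.support t ∩ B
  have hF : MeasurableSet F := (measurableSet_support ht).inter hB.1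
  have hμF : μ F < ∞ := by
    rwa [Measure.restrict_apply (measurableSet_support ht)] at hsupp
  have hintF : ∫⁻ ω in F, t ω ∂μ = ∫⁻ ω in B, t ω ∂μ := by
    rw [← Measure.restrict_restrict (measurableSet_support ht),
      setLIntegral_eq_of_support_subset subset_rfl]
  obtain ⟨δ, hδ, hlarge⟩ :=
    exists_pos_forall_lt_setLIntegral_of_measure_diff_lt (hintF ▸ hfin) (hintF ▸ hLt)
  have hproj : F ⊆ Prod.fst '' {q : Ω × W | t q.1 < Φ q} := fun ω hω => by
    obtain ⟨x, hx⟩ := lt_iSup_iff.1 (htΦ ω hω.1)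
    exact ⟨(ω, x), hx, rfl⟩
  have hμF0 : μ F ≠ 0 := fun h => by
    rw [← hintF, setLIntegral_measure_zero _ _ h] at hLt
    exact not_lt_zero hLt
  obtain ⟨E, hEF, hE, hFE, u₁, hu₁, hbdd, hsel⟩ :=
    exists_measurable_bounded_selection_measure_diff_lt hF hμF hμF0
      (measurableSet_lt (ht.comp measurable_fst) hΦ) hproj (ENNReal.half_pos hδ.ne')
  obtain ⟨G, hGE, hG, hEG, hGR⟩ := hdec u₀ hu₀ E hE ((measure_mono hEF).trans_lt hμF) (δ / 2)
    (ENNReal.half_pos hδ.ne') (fun ω => (u₁ ω : M))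
    (continuous_subtype_val.comp_stronglyMeasurable
      (hu₁.comp measurable_subtype_coe).stronglyMeasurable) (by
      rwa [← image_image, Bornology.isBounded_image_subtype_val])
  have hFG : μ (F \ G) < δ := calc
    μ (F \ G) ≤ μ (F \ E) + μ (E \ G) :=
      (measure_mono (sdiff_triangle F E G)).trans (measure_union_le _ _)
    _ < δ / 2 + δ / 2 := ENNReal.add_lt_add hFE hEG
    _ = δ := ENNReal.add_halves δ
  refine ⟨G, (hGE.trans hEF).trans inter_subset_right, hG, u₁, hGR,
    fun ω hω => zero_le.trans_lt (hsel ω (hGE hω)), ?_⟩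
  exact (hlarge G (hGE.trans hEF) hG hFG).trans_le <| setLIntegral_mono' hG fun ω hω =>
    (hsel ω (hGE hω)).le

end Decomposable

section Integrand

theorem infOver_anti {Ω M : Type*} (f : Ω → M → EReal) : Antitone (infOver f) :=
  fun _ _ h _ => biInf_mono fun _ hx => h hx

theorem infOver_le {Ω M : Type*} (f : Ω → M → EReal) {W : Set M} {x : M} (hx : x ∈ W) (ω : Ω) :
    infOver f W ω ≤ f ω x :=
  biInf_le _ hx

variable {Ω M : Type*} [MeasurableSpace Ω] {μ : Measure Ω} {f : Ω → M → EReal}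
  {u : Ω → M} {m : Ω → EReal} {A B T : Set Ω} {W : Set M}

theorem setLIntegral_toENNReal_comp_ne_top (hI : integralFunctional μ f u ≠ ⊤)
    (hA : A ∈ atomSigmaRing μ) : ∫⁻ ω in A, (f ω (u ω)).toENNReal ∂μ ≠ ∞ :=
  ne_top_of_le_ne_top (exhIntegralFamily_ne_top_iff.1 hI)
    (setLIntegral_le_exhLIntegral (φ := fun _ ω => (f ω (u ω)).toENNReal) hA)

variable [MetricSpace M]

/-- The pointwise infima of the integrand over separable sets are nonnegative on every atom of
infinite measure. -/
def NonnegOnInfiniteAtoms (μ : Measure Ω) (f : Ω → M → EReal) : Prop :=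
  ∀ A, IsMeasureAtom μ A → μ A = ∞ → ∀ W : Set M, IsSeparable W →
    ∀ᵐ ω ∂μ.restrict A, 0 ≤ infOver f W ω

theorem IntStronglyMeasurable.isSeparable_image (hu : IntStronglyMeasurable μ u)
    (hA : A ∈ atomSigmaRing μ) : IsSeparable (u '' A) := by
  obtain ⟨C, hC, hCt, rfl⟩ := mem_atomSigmaRing_iff.1 hA
  have := hC.to_subtype
  rw [sUnion_eq_iUnion, image_iUnion]
  refine IsSeparable.iUnion fun T => ?_
  rw [image_eq_range]
  exact (hu T (hCt T T.2)).isSeparable_range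

theorem IsEssInfOn.ae_le_comp (hm : IsEssInfOn μ A (infFamily f) m) (hA : A ∈ atomSigmaRing μ)
    (hu : IntStronglyMeasurable μ u) : ∀ᵐ ω ∂μ.restrict A, m ω ≤ f ω (u ω) := by
  filter_upwards [hm.2.1 ⟨u '' A, hu.isSeparable_image hA⟩,
    ae_restrict_mem (measurableSet_of_mem_atomSigmaRing hA)] with ω hω hωA
  exact hω.trans (infOver_le f (mem_image_of_mem u hωA) ω)

variable [MeasurableSpace M]

theorem IntSeparablyMeasurable.exists_measurable_extension (hf : IntSeparablyMeasurable μ f)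
    (hT : IsTestSet μ T) (hW : IsSeparable W) :
    ∃ g : Ω × W → EReal, Measurable g ∧ ∀ ω ∈ T, ∀ x : W, g (ω, x) = f ω x := by
  obtain ⟨g, hg, hgf⟩ := ((MeasurableEmbedding.subtype_coe hT.measurableSet).prodMap
    MeasurableEmbedding.id).exists_measurable_extend (hf T hT W hW) fun _ => ⟨0⟩
  exact ⟨g, hg, fun ω hω x => congrFun hgf (⟨ω, hω⟩, x)⟩

variable [BorelSpace M]

theorem IntSeparablyMeasurable.aemeasurable_comp (hf : IntSeparablyMeasurable μ f)
    (hu : IntStronglyMeasurable μ u) (hA : A ∈ atomSigmaRing μ) :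
    AEMeasurable (fun ω => f ω (u ω)) (μ.restrict A) := by
  refine aemeasurable_of_forall_testSet hA fun T _ hT =>
    aemeasurable_restrict_of_measurable_subtype hT.measurableSet ?_
  have hgraph : Measurable fun ω : T => (ω, (⟨u ω, mem_image_of_mem u ω.2⟩ : u '' T)) :=
    measurable_id.prodMk (hu T hT).measurable.subtype_mk
  exact (hf T hT _ (hu.isSeparable_image hT.mem_atomSigmaRing)).comp hgraph

theorem IntSeparablyMeasurable.ae_comp_nonpos (hf : IntSeparablyMeasurable μ f)
    (hu : IntStronglyMeasurable μ u) (hI : integralFunctional μ f u ≠ ⊤)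
    (hT : IsMeasureAtom μ T) (hTi : μ T = ∞) : ∀ᵐ ω ∂μ.restrict T, f ω (u ω) ≤ 0 := by
  have hTr := IsTestSet.mem_atomSigmaRing (.inl hT)
  exact (hT.ae_eq_zero_of_lintegral_ne_top hTi (hf.aemeasurable_comp hu hTr).ereal_toENNReal
    (setLIntegral_toENNReal_comp_ne_top hI hTr)).mono fun ω => EReal.toENNReal_eq_zero_iff.1

theorem NonnegOnInfiniteAtoms.infOver_ae_eq_zero (hatom : NonnegOnInfiniteAtoms μ f)
    (hf : IntSeparablyMeasurable μ f) (hu : IntStronglyMeasurable μ u)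
    (hI : integralFunctional μ f u ≠ ⊤) (hT : IsMeasureAtom μ T) (hTi : μ T = ∞)
    (hW : IsSeparable W) (huW : u '' T ⊆ W) : infOver f W =ᵐ[μ.restrict T] 0 := by
  filter_upwards [hatom T hT hTi W hW, hf.ae_comp_nonpos hu hI hT hTi, ae_restrict_mem hT.1]
    with ω hnonneg hnonpos hω
  exact ((infOver_le f (huW (mem_image_of_mem u hω)) ω).trans hnonpos).antisymm hnonneg

variable [CompleteSpace M]

theorem IntSeparablyMeasurable.aemeasurable_infOver (hf : IntSeparablyMeasurable μ f)
    (hW : IsSeparable W) (hWc : IsClosed W) (hB : IsSigmaFiniteSet μ B) :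
    AEMeasurable (infOver f W) (μ.restrict B) := by
  have := hB.2
  have : SeparableSpace W := hW.separableSpace
  have : CompleteSpace W := hWc.completeSpace_coe
  obtain ⟨g, hg, hgf⟩ := hf.exists_measurable_extension (.inr hB) hW
  refine (aemeasurable_iInf_of_polishSpace hg (μ.restrict B)).congr ?_
  filter_upwards [ae_restrict_mem hB.1] with ω hω
  simp only [infOver, iInf_subtype', hgf ω hω]

end Integrand

section Attainment

variable {Ω M : Type*} [MeasurableSpace Ω] {μ : Measure Ω} [MetricSpace M]
  {f : Ω → M → EReal} {u : Ω → M} {m : Ω → EReal} {A B : Set Ω} {W : Set M}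

/-- The essential infimum function on `A` of the pointwise infima over separable sets is attained
by the closed separable set `W`. -/
structure AttainsEssInfOn (μ : Measure Ω) (f : Ω → M → EReal) (A : Set Ω) (W : Set M) : Prop where
  isSeparable : IsSeparable W
  isClosed : IsClosed W
  aemeasurable : AEMeasurable (infOver f W) (μ.restrict A)
  ae_le : ∀ V : Set M, IsSeparable V → infOver f W ≤ᵐ[μ.restrict A] infOver f V

theorem AttainsEssInfOn.mono (h : AttainsEssInfOn μ f B W) (hAB : A ⊆ B) :
    AttainsEssInfOn μ f A W where
  isSeparable := h.isSeparable
  isClosed := h.isClosed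
  aemeasurable := h.aemeasurable.mono_measure (Measure.restrict_mono_set μ hAB)
  ae_le V hV := ae_mono (Measure.restrict_mono_set μ hAB) (h.ae_le V hV)

theorem AttainsEssInfOn.isEssInfOn_iff (h : AttainsEssInfOn μ f A W) :
    IsEssInfOn μ A (infFamily f) m ↔ m =ᵐ[μ.restrict A] infOver f W := by
  refine ⟨fun hm => ?_, fun hm => ⟨h.aemeasurable.congr hm.symm, fun V => ?_, fun n _ hn => ?_⟩⟩
  · have hle : m ≤ᵐ[μ.restrict A] infOver f W := hm.2.1 ⟨W, h.isSeparable⟩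
    exact hle.antisymm (hm.2.2 _ h.aemeasurable fun V => h.ae_le V V.2)
  · exact hm.trans_le (h.ae_le V V.2)
  · exact Filter.EventuallyLE.trans (hn ⟨W, h.isSeparable⟩) hm.symm.le

variable [MeasurableSpace M] [BorelSpace M] [CompleteSpace M]

theorem IntSeparablyMeasurable.exists_attainsEssInfOn_of_isSigmaFiniteSet
    (hf : IntSeparablyMeasurable μ f) (hB : IsSigmaFiniteSet μ B) :
    ∃ W, AttainsEssInfOn μ f B W := by
  have := hB.2
  have : Nonempty {W : Set M // IsSeparable W ∧ IsClosed W} :=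
    ⟨⟨∅, countable_empty.isSeparable, isClosed_empty⟩⟩
  have hmeas : ∀ W : {W : Set M // IsSeparable W ∧ IsClosed W},
      AEMeasurable (infOver f W.1) (μ.restrict B) := fun W =>
    hf.aemeasurable_infOver W.2.1 W.2.2 hB
  obtain ⟨W, hW⟩ := exists_forall_ae_le hmeas fun s =>
    ⟨⟨closure (⋃ n, (s n).1), (IsSeparable.iUnion fun n => (s n).2.1).closure, isClosed_closure⟩,
      fun n => ae_of_all _ <| infOver_anti f <|
        (subset_iUnion (fun n => (s n).1) n).trans subset_closure⟩
  refine ⟨W.1, W.2.1, W.2.2, hmeas W, fun V hV => ?_⟩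
  exact (hW ⟨closure V, hV.closure, isClosed_closure⟩).trans
    (ae_of_all _ (infOver_anti f subset_closure))

theorem NonnegOnInfiniteAtoms.exists_attainsEssInfOn (hatom : NonnegOnInfiniteAtoms μ f)
    (hf : IntSeparablyMeasurable μ f) (hu : IntStronglyMeasurable μ u)
    (hI : integralFunctional μ f u ≠ ⊤) (hA : A ∈ atomSigmaRing μ) :
    ∃ W, AttainsEssInfOn μ f A W := by
  obtain ⟨B, -, hB, hoff⟩ := exists_isSigmaFiniteSet_subset hA
  obtain ⟨V, hV⟩ := hf.exists_attainsEssInfOn_of_isSigmaFiniteSet hB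
  let W : Set M := closure (V ∪ u '' A)
  have hVW : V ⊆ W := subset_union_left.trans subset_closure
  have huW : u '' A ⊆ W := subset_union_right.trans subset_closure
  have hW : IsSeparable W := (hV.isSeparable.union (hu.isSeparable_image hA)).closure
  have hzero : ∀ T ⊆ A, IsMeasureAtom μ T → μ T = ∞ → infOver f W =ᵐ[μ.restrict T] 0 :=
    fun T hTA hT hTi =>
      hatom.infOver_ae_eq_zero hf hu hI hT hTi hW ((image_mono hTA).trans huW)
  refine ⟨W, hW, isClosed_closure, ?_, fun V' hV' => ?_⟩
  · refine aemeasurable_of_forall_testSet hA fun T hTA hT => ?_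
    rcases hT with hT | hT
    · rcases eq_or_ne (μ T) ∞ with hTi | hTi
      · exact aemeasurable_const.congr (hzero T hTA hT hTi).symm
      · exact hf.aemeasurable_infOver hW isClosed_closure
          (isSigmaFiniteSet_of_measure_lt_top hT.1 hTi.lt_top)
    · exact hf.aemeasurable_infOver hW isClosed_closure hT
  · have hoffB := hoff (fun ω => infOver f W ω ≤ infOver f V' ω) fun T hTA hT hTi =>
      (hzero T hTA hT hTi).trans_le (hatom T hT hTi V' hV')
    filter_upwards [hoffB, ae_restrict_of_ae ((ae_restrict_iff' hB.1).1 (hV.ae_le V' hV'))]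
      with ω h₁ h₂
    by_cases hω : ω ∈ B
    · exact (infOver_anti f hVW ω).trans (h₂ hω)
    · exact h₁ hω

theorem NonnegOnInfiniteAtoms.isExhaustingFamily (hatom : NonnegOnInfiniteAtoms μ f)
    (hf : IntSeparablyMeasurable μ f) (hu : IntStronglyMeasurable μ u)
    (hI : integralFunctional μ f u ≠ ⊤) {m : Set Ω → Ω → EReal}
    (hm : ∀ A ∈ atomSigmaRing μ, IsEssInfOn μ A (infFamily f) (m A)) :
    IsExhaustingFamily μ m := by
  refine ⟨fun A hA => (hm A hA).1, fun A hA B hB hAB => ?_⟩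
  obtain ⟨W, hW⟩ := hatom.exists_attainsEssInfOn hf hu hI hB
  have hB' : m B =ᵐ[μ.restrict A] infOver f W :=
    ae_mono (Measure.restrict_mono_set μ hAB) (hW.isEssInfOn_iff.1 (hm B hB))
  exact ((hW.mono hAB).isEssInfOn_iff.1 (hm A hA)).trans hB'.symm

end Attainment

section Interchange

variable {Ω M : Type*} [MeasurableSpace Ω] {μ : Measure Ω} [MetricSpace M] [MeasurableSpace M]
  [BorelSpace M] {R : Set (Ω → M)} {f : Ω → M → EReal} {u : Ω → M} {A B : Set Ω} {W : Set M}
  {L : ℝ≥0∞}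

theorem NonnegOnInfiniteAtoms.exists_setLIntegral_gap_eq (hatom : NonnegOnInfiniteAtoms μ f)
    (hf : IntSeparablyMeasurable μ f) (hu : IntStronglyMeasurable μ u)
    (hI : integralFunctional μ f u ≠ ⊤) (hA : A ∈ atomSigmaRing μ) (hW : IsSeparable W) :
    ∃ B ⊆ A, IsSigmaFiniteSet μ B ∧
      ∫⁻ ω in A, gap (f ω (u ω)).toENNReal (infOver f W ω) ∂μ =
        ∫⁻ ω in B, gap (f ω (u ω)).toENNReal (infOver f W ω) ∂μ := by
  obtain ⟨B, hBA, hB, hoff⟩ := exists_isSigmaFiniteSet_subset hA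
  have hzero := hoff (fun ω => gap (f ω (u ω)).toENNReal (infOver f W ω) = 0) fun T _ hT hTi => by
    filter_upwards [hatom T hT hTi W hW, hf.ae_comp_nonpos hu hI hT hTi] with ω hnonneg hnonpos
    rw [EReal.toENNReal_of_nonpos hnonpos, gap_zero_of_nonneg hnonneg]
  refine ⟨B, hBA, hB, ?_⟩
  rw [← Measure.restrict_restrict_of_subset hBA, ← lintegral_indicator hB.1]
  refine lintegral_congr_ae (hzero.mono fun ω hω => ?_)
  by_cases hωB : ω ∈ B
  · rw [indicator_of_mem hωB]
  · rw [indicator_of_notMem hωB]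
    exact hω hωB

variable [CompleteSpace M]

open Classical in
theorem AlmostDecomposable.exists_lt_setLIntegral_gap (hdec : AlmostDecomposable μ R)
    (hf : IntSeparablyMeasurable μ f) (hu : IntStronglyMeasurable μ u) (huR : u ∈ R)
    (hI : integralFunctional μ f u ≠ ⊤) (hW : IsSeparable W) (hWc : IsClosed W)
    (hB : IsSigmaFiniteSet μ B)
    (hL : L < ∫⁻ ω in B, gap (f ω (u ω)).toENNReal (infOver f W ω) ∂μ) :
    ∃ v ∈ R, (∀ᵐ ω ∂μ, f ω (v ω) ≤ (f ω (u ω)).toENNReal) ∧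
      L < ∫⁻ ω in B, gap (f ω (u ω)).toENNReal (f ω (v ω)) ∂μ := by
  have : SeparableSpace W := hW.separableSpace
  have : CompleteSpace W := hWc.completeSpace_coe
  have hBr := hB.mem_atomSigmaRing
  have hp := (hf.aemeasurable_comp hu hBr).ereal_toENNReal
  obtain ⟨g, hg, hgf⟩ := hf.exists_measurable_extension (.inr hB) hW
  let Φ : Ω × W → ℝ≥0∞ := fun q => gap (hp.mk _ q.1) (g q)
  have hΦ : Measurable Φ := measurable_gap.comp ((hp.measurable_mk.comp measurable_fst).prodMk hg)
  have hΦf : ∀ᵐ ω ∂μ, ω ∈ B → ∀ x, Φ (ω, x) = gap (f ω (u ω)).toENNReal (f ω x) := by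
    filter_upwards [(ae_restrict_iff' hB.1).1 hp.ae_eq_mk] with ω hω hωB x
    rw [hω hωB, ← hgf ω hωB x]
  have hsup : ∫⁻ ω in B, gap (f ω (u ω)).toENNReal (infOver f W ω) ∂μ =
      ∫⁻ ω in B, ⨆ x, Φ (ω, x) ∂μ := by
    refine lintegral_congr_ae ?_
    filter_upwards [(ae_restrict_iff' hB.1).2 hΦf,
      ae_lt_top' hp (setLIntegral_toENNReal_comp_ne_top hI hBr)] with ω hω htop
    simp only [infOver, iInf_subtype', gap_iInf htop.ne, hω]
  obtain ⟨G, hGB, hG, v, hvR, hpos, hLG⟩ := hdec.exists_lt_setLIntegral huR hΦ hB (hsup ▸ hL)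
  refine ⟨_, hvR, ?_, hLG.trans_le ?_⟩
  · filter_upwards [hΦf] with ω hω
    by_cases hωG : ω ∈ G
    · rw [piecewise_eq_of_mem _ _ _ hωG]
      exact (lt_of_gap_pos (hω (hGB hωG) _ ▸ hpos ω hωG)).le
    · rw [piecewise_eq_of_notMem _ _ _ hωG]
      exact le_coe_toENNReal _
  · refine le_trans (lintegral_mono_ae ?_) (lintegral_mono_set hGB)
    filter_upwards [(ae_restrict_iff' hG).2 (hΦf.mono fun ω h hωG => h (hGB hωG)),
      ae_restrict_mem hG] with ω hω hωG
    rw [hω, piecewise_eq_of_mem _ _ _ hωG]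

theorem AlmostDecomposable.exists_lt_exhLIntegral_gap (hdec : AlmostDecomposable μ R)
    (hatom : NonnegOnInfiniteAtoms μ f) (hf : IntSeparablyMeasurable μ f)
    (hu : IntStronglyMeasurable μ u) (huR : u ∈ R) (hI : integralFunctional μ f u ≠ ⊤)
    {m : Set Ω → Ω → EReal} (hm : ∀ A ∈ atomSigmaRing μ, IsEssInfOn μ A (infFamily f) (m A))
    (hL : L < exhLIntegral μ fun A ω => gap (f ω (u ω)).toENNReal (m A ω)) :
    ∃ v ∈ R, (∀ᵐ ω ∂μ, f ω (v ω) ≤ (f ω (u ω)).toENNReal) ∧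
      L < exhLIntegral μ fun _ ω => gap (f ω (u ω)).toENNReal (f ω (v ω)) := by
  simp only [exhLIntegral, lt_iSup_iff] at hL
  obtain ⟨A, hA, hLA⟩ := hL
  obtain ⟨W, hW⟩ := hatom.exists_attainsEssInfOn hf hu hI hA
  have hmW : ∫⁻ ω in A, gap (f ω (u ω)).toENNReal (m A ω) ∂μ =
      ∫⁻ ω in A, gap (f ω (u ω)).toENNReal (infOver f W ω) ∂μ :=
    lintegral_congr_ae ((hW.isEssInfOn_iff.1 (hm A hA)).mono fun ω hω => by
      simp only [hω])
  obtain ⟨B, -, hB, hAB⟩ := hatom.exists_setLIntegral_gap_eq hf hu hI hA hW.isSeparable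
  obtain ⟨v, hvR, hle, hLv⟩ := hdec.exists_lt_setLIntegral_gap hf hu huR hI hW.isSeparable
    hW.isClosed hB (hAB ▸ hmW ▸ hLA)
  exact ⟨v, hvR, hle, hLv.trans_le <|
    setLIntegral_le_exhLIntegral (φ := fun _ ω => gap (f ω (u ω)).toENNReal (f ω (v ω)))
      hB.mem_atomSigmaRing⟩

theorem iInf_integralFunctional_eq (hdec : AlmostDecomposable μ R)
    (hR : ∀ u ∈ R, IntStronglyMeasurable μ u) (hatom : NonnegOnInfiniteAtoms μ f)
    (hf : IntSeparablyMeasurable μ f) (huR : u ∈ R) (hI : integralFunctional μ f u ≠ ⊤)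
    {m : Set Ω → Ω → EReal} (hm : ∀ A ∈ atomSigmaRing μ, IsEssInfOn μ A (infFamily f) (m A)) :
    ⨅ v ∈ R, integralFunctional μ f v = exhIntegralFamily μ m := by
  have hmeas : ∀ v ∈ R, IsExhaustingFamily μ fun _ ω => f ω (v ω) := fun v hv =>
    isExhaustingFamily_const_iff.2 fun A => hf.aemeasurable_comp (hR v hv)
  set p : Set Ω → Ω → ℝ≥0∞ := fun _ ω => (f ω (u ω)).toENNReal
  have hp : IsExhaustingFamily μ p := (hmeas u huR).comp measurable_ereal_toENNReal
  have hfin : exhLIntegral μ p ≠ ∞ := exhIntegralFamily_ne_top_iff.1 hI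
  have hmfam := hatom.isExhaustingFamily hf (hR u huR) hI hm
  have hmle : ∀ A ∈ atomSigmaRing μ, ∀ᵐ ω ∂μ.restrict A, m A ω ≤ p A ω := fun A hA =>
    ((hm A hA).ae_le_comp hA (hR u huR)).mono fun ω hω => hω.trans (le_coe_toENNReal _)
  refine le_antisymm ?_ (le_iInf₂ fun v hv => exhIntegralFamily_mono fun A hA =>
    (hm A hA).ae_le_comp hA (hR v hv))
  rw [exhIntegralFamily_eq_sub_exhLIntegral_gap hp hmfam hfin hmle]
  refine le_coe_ennreal_sub_of_forall_lt hfin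
    ((iInf₂_le u huR).trans exhIntegralFamily_le_exhLIntegral_toENNReal) fun L hL => ?_
  obtain ⟨v, hvR, hle, hLv⟩ :=
    hdec.exists_lt_exhLIntegral_gap hatom hf (hR u huR) huR hI hm hL
  refine (iInf₂_le v hvR).trans ?_
  rw [integralFunctional, exhIntegral, exhIntegralFamily_eq_sub_exhLIntegral_gap hp (hmeas v hvR)
    hfin fun A _ => ae_restrict_of_ae hle]
  exact EReal.sub_le_sub le_rfl (EReal.coe_ennreal_le_coe_ennreal_iff.2 hLv.le)

end Interchange

section EssInf

variable {Ω ι : Type*} [MeasurableSpace Ω] {μ : Measure Ω} {v : ι → Ω → EReal}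
  {m n : Ω → EReal} {k : Set Ω → Ω → EReal} {A : Set Ω}

theorem IsEssInfOn.congr (hm : IsEssInfOn μ A v m) (h : m =ᵐ[μ.restrict A] n) :
    IsEssInfOn μ A v n :=
  ⟨hm.1.congr h, fun i => h.symm.trans_le (hm.2.1 i), fun n' hn' hle =>
    Filter.EventuallyLE.trans (hm.2.2 n' hn' hle) h.le⟩

theorem IsEssInf.ae_eq (hm : IsEssInf μ v m) (hn : IsEssInf μ v n) : m =ᵐ[μ] n :=
  Filter.EventuallyLE.antisymm (hn.2.2 m hm.1 hm.2.1) (hm.2.2 n hn.1 hn.2.1)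

theorem isEssInf_of_forall_isEssInfOn (hm : AEMeasurable m μ)
    (h : ∀ A ∈ atomSigmaRing μ, IsEssInfOn μ A v m) : IsEssInf μ v m := by
  refine ⟨hm, fun i => intAE_iff_forall_mem_atomSigmaRing.2 fun A hA => (h A hA).2.1 i,
    fun n hn hle => ?_⟩
  refine (intAE_iff_ae (nullMeasurableSet_le hn hm).compl).1 ?_
  exact intAE_iff_forall_mem_atomSigmaRing.2 fun A hA => (h A hA).2.2 n hn.restrict fun i =>
    intAE_iff_forall_mem_atomSigmaRing.1 (hle i) A hA

theorem IsExhaustingFamily.exists_aemeasurable_forall_isEssInfOn (hk : IsExhaustingFamily μ k)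
    (hess : ∀ A ∈ atomSigmaRing μ, IsEssInfOn μ A v (k A)) (htop : exhIntegralFamily μ k ≠ ⊤)
    (hbot : exhIntegralFamily μ k ≠ ⊥) :
    ∃ m, AEMeasurable m μ ∧ ∀ A ∈ atomSigmaRing μ, IsEssInfOn μ A v m := by
  obtain ⟨m, hm, hkm⟩ := hk.exists_aemeasurable_forall_ae_eq htop hbot
  exact ⟨m, hm, fun A hA => (hess A hA).congr (hkm A hA)⟩

theorem IsEssInf.isEssInfOn (hm : IsEssInf μ v m) (hn : AEMeasurable n μ)
    (h : ∀ A ∈ atomSigmaRing μ, IsEssInfOn μ A v n) (hA : A ∈ atomSigmaRing μ) :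
    IsEssInfOn μ A v m :=
  (h A hA).congr (ae_restrict_of_ae ((isEssInf_of_forall_isEssInfOn hn h).ae_eq hm))

end EssInf

section Minimizers

variable {Ω M : Type*} [MeasurableSpace Ω] {μ : Measure Ω} [MetricSpace M] [MeasurableSpace M]
  [BorelSpace M] {R : Set (Ω → M)} {f : Ω → M → EReal} {u : Ω → M} {m : Ω → EReal}

theorem isMinOn_integralFunctional_iff (hf : IntSeparablyMeasurable μ f)
    (hu : IntStronglyMeasurable μ u) (huR : u ∈ R)
    (hm : ∀ A ∈ atomSigmaRing μ, IsEssInfOn μ A (infFamily f) m)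
    (hval : ⨅ v ∈ R, integralFunctional μ f v = exhIntegral μ m)
    (htop : exhIntegral μ m ≠ ⊤) (hbot : exhIntegral μ m ≠ ⊥) :
    IsMinOn (integralFunctional μ f) R u ↔ IntAE μ fun ω => f ω (u ω) = m ω := by
  have hiff : IsMinOn (integralFunctional μ f) R u ↔
      exhIntegral μ m = exhIntegral μ fun ω => f ω (u ω) := by
    rw [← hval]
    exact ⟨fun h => (iInf₂_le u huR).antisymm (le_iInf₂ fun v hv => h hv),
      fun h v hv => h.ge.trans (iInf₂_le v hv)⟩
  rw [hiff, intAE_iff_forall_mem_atomSigmaRing]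
  refine ⟨fun h A hA => ?_, fun h => exhIntegralFamily_congr fun A hA =>
    Filter.EventuallyEq.symm (h A hA)⟩
  exact (ae_eq_of_exhIntegralFamily_eq
    (isExhaustingFamily_const_iff.2 fun A hA => (hm A hA).1)
    (isExhaustingFamily_const_iff.2 fun A hA => hf.aemeasurable_comp hu hA)
    (fun A hA => (hm A hA).ae_le_comp hA hu) h htop hbot hA).symm

variable [CompleteSpace M]

/-- Since `m ≤ f (u)`, finiteness of both integrals leaves only `m = f (u) = 0` outside some `A` in
the `σ`-ring, so there any separable set containing the values of `u` attains the infimum. -/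
theorem NonnegOnInfiniteAtoms.exists_isSeparable_intAE_eq_infOver
    (hatom : NonnegOnInfiniteAtoms μ f) (hf : IntSeparablyMeasurable μ f)
    (hu : IntStronglyMeasurable μ u) (hI : integralFunctional μ f u ≠ ⊤)
    (hm : ∀ A ∈ atomSigmaRing μ, IsEssInfOn μ A (infFamily f) m) (hbot : exhIntegral μ m ≠ ⊥)
    {V : Set M} (hV : IsSeparable V) (huV : IntAE μ fun ω => u ω ∈ V) :
    ∃ W : Set M, IsSeparable W ∧ IntAE μ fun ω => m ω = infOver f W ω := by
  have hmtop : exhIntegral μ m ≠ ⊤ := ne_top_of_le_ne_top hI <|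
    exhIntegralFamily_mono fun A hA => (hm A hA).ae_le_comp hA hu
  obtain ⟨A, hA, hsign⟩ := IsExhaustingFamily.exists_forall_ae_notMem_le_zero_le
    (isExhaustingFamily_const_iff.2 fun A => hf.aemeasurable_comp hu)
    (isExhaustingFamily_const_iff.2 fun A hA => (hm A hA).1) hI hmtop hbot
  obtain ⟨W, hW⟩ := hatom.exists_attainsEssInfOn hf hu hI hA
  have hmW := (ae_restrict_iff' (measurableSet_of_mem_atomSigmaRing hA)).1
    (hW.isEssInfOn_iff.1 (hm A hA))
  have hWV : IsSeparable (W ∪ V) := hW.isSeparable.union hV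
  refine ⟨W ∪ V, hWV, intAE_iff_forall_mem_atomSigmaRing.2 fun B hB => ?_⟩
  filter_upwards [(hm B hB).2.1 ⟨W ∪ V, hWV⟩, ae_restrict_of_ae hmW,
    intAE_iff_forall_mem_atomSigmaRing.1 huV B hB, hsign B hB] with ω hle hωW hωV hωsign
  refine le_antisymm hle ?_
  by_cases hωA : ω ∈ A
  · exact (infOver_anti f subset_union_left ω).trans_eq (hωW hωA).symm
  · calc infOver f (W ∪ V) ω ≤ f ω (u ω) := infOver_le f (subset_union_right hωV) ω
      _ ≤ 0 := (hωsign hωA).1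
      _ ≤ m ω := (hωsign hωA).2

end Minimizers

end InfInt

theorem theorem2p3 {Ω M : Type*} [MeasurableSpace Ω] (μ : Measure Ω)
    [MetricSpace M] [CompleteSpace M] [MeasurableSpace M] [BorelSpace M]
    (R : Set (Ω → M)) (hR : ∀ u ∈ R, InfInt.IntStronglyMeasurable μ u)
    (hdec : InfInt.AlmostDecomposable μ R)
    (f : Ω → M → EReal) (hf : InfInt.IntSeparablyMeasurable μ f)
    (hatom : ∀ A, InfInt.IsMeasureAtom μ A → μ A = ∞ → ∀ W : Set M, IsSeparable W →
      ∀ᵐ ω ∂μ.restrict A, 0 ≤ InfInt.infOver f W ω)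
    (hdom : ∃ u ∈ R, InfInt.integralFunctional μ f u ≠ ⊤) :
    -- the essential infimum exists on every set of the `σ`-ring
    (∀ A ∈ InfInt.atomSigmaRing μ, ∃ m, InfInt.IsEssInfOn μ A (InfInt.infFamily f) m) ∧
    -- the interchange formula
    (∀ m : Set Ω → Ω → EReal,
      (∀ A ∈ InfInt.atomSigmaRing μ, InfInt.IsEssInfOn μ A (InfInt.infFamily f) (m A)) →
        (⨅ u ∈ R, InfInt.integralFunctional μ f u) = InfInt.exhIntegralFamily μ m) ∧
    ((⨅ u ∈ R, InfInt.integralFunctional μ f u) ≠ ⊥ →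
      -- the essential infimum exists on the whole space
      (∃ m, InfInt.IsEssInf μ (InfInt.infFamily f) m) ∧
      ∀ m, InfInt.IsEssInf μ (InfInt.infFamily f) m →
        -- it represents the common value
        (⨅ u ∈ R, InfInt.integralFunctional μ f u) = InfInt.exhIntegral μ m ∧
        -- it is attained by a separable set, on each set of the `σ`-ring ...
        (∀ A ∈ InfInt.atomSigmaRing μ, ∃ W : Set M, IsSeparable W ∧
          ∀ᵐ ω ∂μ.restrict A, m ω = InfInt.infOver f W ω) ∧
        -- ... and on the whole space if some `u ∈ R` with `I_f(u) < ∞` is separably valued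
        ((∃ u ∈ R, InfInt.integralFunctional μ f u ≠ ⊤ ∧
            ∃ V : Set M, IsSeparable V ∧ InfInt.IntAE μ fun ω => u ω ∈ V) →
          ∃ W : Set M, IsSeparable W ∧ InfInt.IntAE μ fun ω => m ω = InfInt.infOver f W ω) ∧
        -- pointwise characterization of minimizers
        ∀ u ∈ R,
          (IsMinOn (InfInt.integralFunctional μ f) R u ↔
            InfInt.IntAE μ fun ω => f ω (u ω) = m ω) ∧
          (AEMeasurable (fun ω => f ω (u ω)) μ →
            (IsMinOn (InfInt.integralFunctional μ f) R u ↔ ∀ᵐ ω ∂μ, f ω (u ω) = m ω))) := by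
  obtain ⟨u₀, hu₀R, hI⟩ := hdom
  have hu₀ := hR u₀ hu₀R
  have hattain {A : Set Ω} (hA : A ∈ InfInt.atomSigmaRing μ) :
      ∃ W, InfInt.AttainsEssInfOn μ f A W :=
    InfInt.NonnegOnInfiniteAtoms.exists_attainsEssInfOn hatom hf hu₀ hI hA
  have hex : ∀ A ∈ InfInt.atomSigmaRing μ, ∃ m, InfInt.IsEssInfOn μ A (InfInt.infFamily f) m :=
    fun A hA => (hattain hA).imp' _ fun W hW => hW.isEssInfOn_iff.2 .rfl
  have hformula := fun m hm =>
    InfInt.iInf_integralFunctional_eq (m := m) hdec hR hatom hf hu₀R hI hm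
  refine ⟨hex, hformula, fun hbot => ?_⟩
  have htop : (⨅ u ∈ R, InfInt.integralFunctional μ f u) ≠ ⊤ :=
    ne_top_of_le_ne_top hI (iInf₂_le u₀ hu₀R)
  choose! k hk using hex
  obtain ⟨n, hn, hnOn⟩ := (InfInt.NonnegOnInfiniteAtoms.isExhaustingFamily hatom hf hu₀ hI
    hk).exists_aemeasurable_forall_isEssInfOn hk (hformula k hk ▸ htop) (hformula k hk ▸ hbot)
  refine ⟨⟨n, InfInt.isEssInf_of_forall_isEssInfOn hn hnOn⟩, fun m hm => ?_⟩
  have hmOn := fun A (hA : A ∈ InfInt.atomSigmaRing μ) => hm.isEssInfOn hn hnOn hA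
  have hval : _ = InfInt.exhIntegral μ m := hformula (fun _ => m) hmOn
  have hmin := fun u (hu : u ∈ R) =>
    InfInt.isMinOn_integralFunctional_iff hf (hR u hu) hu hmOn hval (hval ▸ htop) (hval ▸ hbot)
  refine ⟨hval, fun A hA => ?_, ?_, fun u hu => ⟨hmin u hu, fun hmeas => (hmin u hu).trans <|
    InfInt.intAE_iff_ae (nullMeasurableSet_eq_fun hmeas hm.1).compl⟩⟩
  · exact (hattain hA).imp fun W hW => ⟨hW.isSeparable, hW.isEssInfOn_iff.1 (hmOn A hA)⟩
  · rintro ⟨u, huR, huI, V, hV, huV⟩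
    exact InfInt.NonnegOnInfiniteAtoms.exists_isSeparable_intAE_eq_infOver hatom hf (hR u huR) huI
      hmOn (hval ▸ hbot) hV huV
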